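/- \textbf{Conventions.} A \emph{standard complex Gaussian matrix} has i.i.d. circularly symmetric complex Gaussian entries with zero mean and unit variance (real and imaginary parts independent $N(0,1/2)$). For $A\in\mathbb{C}^{m\times n}$ and $C\in\mathbb{C}^{q\times n}$ put $B=(A^H,C^H)^H$, $k=\operatorname{rank}B$, $r=\operatorname{rank}B-\operatorname{rank}C$, $s=\operatorname{rank}A+\operatorname{rank}C-\operatorname{rank}B$. A generalized singular value decomposition (GSVD) of $(A,C)$ consists of factorizations $$UAQ=(\Sigma_A,\,O),\qquad VCQ=(\Sigma_C,\,O),$$ with unitary $U\in\mathbb{C}^{m\times m}$, $V\in\mathbb{C}^{q\times q}$; block diagonal matrices $$\Sigma_A=\operatorname{diag}(I_r,\,S_A,\,O_A)\in\mathbb{C}^{m\times k},\qquad \Sigma_C=\operatorname{diag}(O_C,\,S_C,\,I_{k-r-s})\in\mathbb{C}^{q\times k},$$ where $O_A$ is the $(m-r-s)\times(k-r-s)$ and $O_C$ the $(q-k+r)\times r$ zero matrix, $S_A=\operatorname{diag}(\alpha_1,\dots,\alpha_s)$, $S_C=\operatorname{diag}(\beta_1,\dots,\beta_s)$, $\alpha_i,\beta_i\ge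 0$ and $\alpha_i^2+\beta_i^2=1$; and $$Q=Q'\begin{pmatrix}(W^HR)^{-1}&\\&O_{n-k}\end{pmatrix},$$ with unitary $Q'\in\mathbb{C}^{n\times n}$, $W\in\mathbb{C}^{k\times k}$ and a nonnegative diagonal $R\in\mathbb{C}^{k\times k}$ whose diagonal entries are the nonzero singular values of $B$ (with multiplicity, in any order). The squared generalized singular values of $(A,C)$ are $w_i=\alpha_i^2/\beta_i^2$, $i=1,\dots,s$. \textbf{Theorem 1.} Let $q\ge m$, and let $A\in\mathbb{C}^{m\times n}$ and $C\in\mathbb{C}^{q\times n}$ be independent standard complex Gaussian matrices. Almost surely a GSVD of $(A,C)$ exists, and its dimensions are $$k=\min\{m+q,n\},\quad r=\min\{m+q,n\}-\min\{q,n\},\quad s=\min\{m,n\}+\min\{q,n\}-\min\{m+q,n\}.$$ (i) Suppose $n<q+m$ or $n\le q$, and let $$(m',p,n')=\begin{cases}(n,m,q), & q\ge n,\\ (q,s,n), & q<n<q+m.\end{cases}$$ Let $X\in\mathbb{C}^{m'\times p}$ and $Y\in\mathbb{C}^{m'\times n'}$ be independent standard complex Gaussian matrices. Then almost surely $YY^H$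 is invertible and $L=X^H(YY^H)^{-1}X$ has exactly $s$ nonzero eigenvalues, counted with multiplicity, all of them real. The squared generalized singular values $w_1,\dots,w_s$ of $(A,C)$ have the same joint distribution, as an unordered $s$-tuple (equivalently, after arranging both families in increasing order), as the nonzero eigenvalues of $L$. (ii) If $q+m\le n$, then $s=0$ and the factors $\Sigma_A$ and $\Sigma_C$ are deterministic, that is, almost surely equal to fixed matrices. -/

import Mathlib

open MeasureTheory ProbabilityTheory
open scoped Matrix

noncomputable section

/-- The law of a (circularly symmetric) complex Gaussian variable with zero mean and unit variance:
real and imaginary parts are independent centred real Gaussians of variance `1 / 2`. -/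
def stdComplexGaussian : Measure ℂ :=
  ((gaussianReal 0 (1 / 2)).prod (gaussianReal 0 (1 / 2))).map
    (fun z : ℝ × ℝ => (⟨z.1, z.2⟩ : ℂ))

/-- A random matrix whose entries are i.i.d. complex Gaussian with zero mean and unit variance. -/
structure IsStdGaussianMatrix {Ω ι κ : Type*} [MeasurableSpace Ω]
    (A : Ω → Matrix ι κ ℂ) (P : Measure Ω) : Prop where
  hasLaw : ∀ i j, HasLaw (fun ω => A ω i j) stdComplexGaussian P
  iIndep : iIndepFun (fun (ij : ι × κ) ω => A ω ij.1 ij.2) P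

/-- Two independent random matrices, each with i.i.d. complex Gaussian entries of zero mean and
unit variance. -/
structure IsIndepStdGaussianPair {Ω ι κ ι' κ' : Type*} [MeasurableSpace Ω]
    (A : Ω → Matrix ι κ ℂ) (C : Ω → Matrix ι' κ' ℂ) (P : Measure Ω) : Prop where
  left : IsStdGaussianMatrix A P
  right : IsStdGaussianMatrix C P
  indep : IndepFun (fun ω (ij : ι × κ) => A ω ij.1 ij.2)
    (fun ω (ij : ι' × κ') => C ω ij.1 ij.2) P

/-- The multiset of nonzero eigenvalues of a square complex matrix, with algebraic multiplicity. -/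
def nonzeroEigenvalues {ι : Type*} [Fintype ι] [DecidableEq ι] (M : Matrix ι ι ℂ) :
    Multiset ℂ :=
  M.charpoly.roots.filter (fun z => z ≠ 0)

/-- The real numbers `v 0, …, v (s - 1)` are, in some order, the nonzero eigenvalues of `M`, each
repeated according to its multiplicity. -/
def IsNonzeroEigenvalueTuple {ι : Type*} [Fintype ι] [DecidableEq ι] {s : ℕ}
    (M : Matrix ι ι ℂ) (v : Fin s → ℝ) : Prop :=
  nonzeroEigenvalues M = Finset.univ.val.map (fun i => (v i : ℂ))

/-- `M` placed in the upper left corner of a `c × d` matrix and completed by zeros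
(used for `a ≤ c` and `b ≤ d`). -/
def padZero {a b : ℕ} (c d : ℕ) (M : Matrix (Fin a) (Fin b) ℂ) : Matrix (Fin c) (Fin d) ℂ :=
  Matrix.of fun i j =>
    if h : (i : ℕ) < a ∧ (j : ℕ) < b then M ⟨i, h.1⟩ ⟨j, h.2⟩ else 0

/-- The `m × k` block diagonal matrix `diag(I_r, diag(α), O)`, where `O` is the zero matrix with
`m - r - s` rows and `k - r - s` columns. -/
def sigmaA (m k r : ℕ) {s : ℕ} (α : Fin s → ℝ) : Matrix (Fin m) (Fin k) ℂ :=
  Matrix.of fun i j =>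
    if (i : ℕ) = j then
      if (j : ℕ) < r then 1
      else if h : (j : ℕ) - r < s then ((α ⟨(j : ℕ) - r, h⟩ : ℝ) : ℂ)
      else 0
    else 0

/-- The `q × k` block diagonal matrix `diag(O, diag(β), I_{k - r - s})`, where `O` is the zero
matrix with `q - (k - r)` rows and `r` columns. Its lower right corner is the corner of the last
identity block, so that its "diagonal" is `i - q = j - k`. -/
def sigmaC (q k r : ℕ) {s : ℕ} (β : Fin s → ℝ) : Matrix (Fin q) (Fin k) ℂ :=
  Matrix.of fun i j =>
    if (i : ℕ) + k = q + j then
      if (j : ℕ) < r then 0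
      else if h : (j : ℕ) - r < s then ((β ⟨(j : ℕ) - r, h⟩ : ℝ) : ℂ)
      else 1
    else 0

/-- A generalized singular value decomposition of the pair `(A, C)`,
`U A Q = (Σ_A, O)` and `V C Q = (Σ_C, O)`, where with `B = (Aᴴ, Cᴴ)ᴴ`
`k = rank B`, `r = rank B - rank C`, `s = rank A + rank C - rank B`, and
`Q = Q' diag((Wᴴ R)⁻¹, O)` with `R = diag(ρ)` carrying the nonzero singular values of `B`. -/
structure GSVD {m n q : ℕ} (A : Matrix (Fin m) (Fin n) ℂ) (C : Matrix (Fin q) (Fin n) ℂ)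
    (k r s : ℕ) where
  /-- the left unitary factor of `A` -/
  U : Matrix (Fin m) (Fin m) ℂ
  /-- the left unitary factor of `C` -/
  V : Matrix (Fin q) (Fin q) ℂ
  /-- the common right factor -/
  Q : Matrix (Fin n) (Fin n) ℂ
  /-- the outer unitary factor of `Q` -/
  Q' : Matrix (Fin n) (Fin n) ℂ
  /-- the inner unitary factor of `Q` -/
  W : Matrix (Fin k) (Fin k) ℂ
  /-- the diagonal of `R` -/
  ρ : Fin k → ℝ
  /-- the diagonal of `S_A` -/
  α : Fin s → ℝ
  /-- the diagonal of `S_C` -/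
  β : Fin s → ℝ
  rank_k : (Matrix.fromRows A C).rank = k
  rank_r : r + C.rank = (Matrix.fromRows A C).rank
  rank_s : s + (Matrix.fromRows A C).rank = A.rank + C.rank
  U_unitary : U ∈ Matrix.unitaryGroup (Fin m) ℂ
  V_unitary : V ∈ Matrix.unitaryGroup (Fin q) ℂ
  Q'_unitary : Q' ∈ Matrix.unitaryGroup (Fin n) ℂ
  W_unitary : W ∈ Matrix.unitaryGroup (Fin k) ℂ
  ρ_nonneg : ∀ i, 0 ≤ ρ i
  ρ_spec : IsNonzeroEigenvalueTuple
    ((Matrix.fromRows A C)ᴴ * Matrix.fromRows A C) (fun i => ρ i ^ 2)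
  Q_eq : Q = Q' * padZero n n (Wᴴ * Matrix.diagonal (fun i => (ρ i : ℂ)))⁻¹
  α_nonneg : ∀ i, 0 ≤ α i
  β_nonneg : ∀ i, 0 ≤ β i
  sq_add_sq : ∀ i, α i ^ 2 + β i ^ 2 = 1
  factor_A : U * A * Q = padZero m n (sigmaA m k r α)
  factor_C : V * C * Q = padZero q n (sigmaC q k r β)

namespace GSVD

variable {m n q k r s : ℕ} {A : Matrix (Fin m) (Fin n) ℂ} {C : Matrix (Fin q) (Fin n) ℂ}

/-- The factor `Σ_A` of a GSVD. -/
def SigmaA (G : GSVD A C k r s) : Matrix (Fin m) (Fin k) ℂ := sigmaA m k r G.α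

/-- The factor `Σ_C` of a GSVD. -/
def SigmaC (G : GSVD A C k r s) : Matrix (Fin q) (Fin k) ℂ := sigmaC q k r G.β

/-- The squared generalized singular values `w i = α i ^ 2 / β i ^ 2`. -/
def w (G : GSVD A C k r s) : Fin s → ℝ := fun i => G.α i ^ 2 / G.β i ^ 2

end GSVD

/-- The increasing rearrangement of a finite real tuple. -/
def sortTuple {s : ℕ} (v : Fin s → ℝ) : Fin s → ℝ := v ∘ Tuple.sort v

end

/-! ### Standard complex Gaussian vectors -/

/-! Existence of a GSVD is linear algebra. Diagonalising `BᴴB` and rescaling makes the columns of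
`B` orthonormal on its row space. The Gram matrices of the `A`-part and the `C`-part then add up to
the identity, so one unitary `W` diagonalises both, and the resulting orthogonal columns complete to
the unitaries `U` and `V` (`nonempty_GSVD`). A nonzero polynomial vanishes only on a Gaussian null
set, so Gaussian matrices almost surely have maximal rank (`ae_rank_eq`), and this fixes `k`, `r`,
`s`.

For the law, everything is read off the normalised pencil determinant `det (t S + T) / det S`. With
`S = AᴴA + CᴴC`, `T = CᴴC` and `k = n` it equals `t ^ r (t + 1) ^ (n - r - s) ∏ (t + 1 / (1 + w i))`
(`GSVD.pencilDet_eq`). With `S = XXᴴ + YYᴴ`, `T = YYᴴ` it equals `(t + 1) ^ (m' - s) ∏ (t + 1 / (1 +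
v i))` (`pencilDet_quotient`). In both cases `S` is the Gram matrix of a Gaussian matrix and `T`
that of some of its rows.

If `n ≤ q`, the two Gaussian matrices have the same shape and the laws agree at once. If `q < n < q
+ m`, the shapes are `N × n` and `N × q` with `N = m + q`, and a duality is needed
(`map_gramPencil_eq`). By unitary invariance, the coordinate projection that selects rows of `B` may
be replaced by the projection onto the column space of an independent Gaussian `D`. The determinant
then becomes symmetric in `B` and `D` up to a power of `t`, by `det (t + FG)` versus `det (t + GF)`.

Finally, the values of the pencil determinant at positive integers determine the sorted tuple
through a measurable map, by Lusin–Souslin (`exists_measurable_leftInverse_tuplePoly`). Hence equal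
laws of pencils give equal laws of sorted tuples, and no measurability of the chosen GSVD or of the
chosen order is needed. -/

lemma stdComplexGaussian_eq_map :
    stdComplexGaussian = ((gaussianReal 0 (1 / 2)).prod (gaussianReal 0 (1 / 2))).map
      (Complex.equivRealProdCLM.symm : ℝ × ℝ →L[ℝ] ℂ) := by
  rfl

instance : IsProbabilityMeasure stdComplexGaussian := by
  rw [stdComplexGaussian_eq_map]
  exact Measure.isProbabilityMeasure_map (by fun_prop)

lemma charFunDual_gaussianReal_half (L : StrongDual ℝ ℝ) :
    charFunDual (gaussianReal 0 (1 / 2)) L = Complex.exp (-((L 1 ^ 2 : ℝ) : ℂ) / 4) := by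
  have h : charFunDual (gaussianReal 0 (1 / 2)) L = charFun (gaussianReal 0 (1 / 2)) (L 1) := by
    rw [charFunDual_apply, charFun_apply_real]
    congr 1
    ext x
    have : L x = L 1 * x := by
      conv_lhs => rw [show x = x • (1 : ℝ) by simp, map_smul]
      simp [mul_comm]
    rw [this]; push_cast; rfl
  rw [h, charFun_gaussianReal]
  congr 1
  push_cast
  ring

lemma charFunDual_stdComplexGaussian (L : StrongDual ℝ ℂ) :
    charFunDual stdComplexGaussian L =
      Complex.exp (-((L 1 ^ 2 + L Complex.I ^ 2 : ℝ) : ℂ) / 4) := by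
  rw [stdComplexGaussian_eq_map, charFunDual_map, charFunDual_prod, charFunDual_gaussianReal_half,
    charFunDual_gaussianReal_half, ← Complex.exp_add]
  have h1 : Complex.equivRealProdCLM.symm ((1 : ℝ), (0 : ℝ)) = 1 := by
    apply Complex.ext <;> simp
  have h2 : Complex.equivRealProdCLM.symm ((0 : ℝ), (1 : ℝ)) = Complex.I := by
    apply Complex.ext <;> simp
  congr 1
  simp only [ContinuousLinearMap.comp_apply, ContinuousLinearMap.inl_apply,
    ContinuousLinearMap.inr_apply, ContinuousLinearEquiv.coe_coe, h1, h2]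
  push_cast
  ring

instance : NullSingletonClass stdComplexGaussian := by
  refine ⟨fun z => ?_⟩
  have hna : NullSingletonClass (gaussianReal 0 (1 / 2)) :=
    nullSingletonClass_gaussianReal (by norm_num)
  rw [stdComplexGaussian_eq_map, Measure.map_apply (by fun_prop) (measurableSet_singleton z)]
  have : (Complex.equivRealProdCLM.symm : ℝ × ℝ →L[ℝ] ℂ) ⁻¹' {z} ⊆ {(z.re, z.im)} := by
    intro x hx
    have hx' : Complex.equivRealProdCLM.symm x = z := hx
    simp [← hx']
  refine measure_mono_null this ?_
  rw [← Set.singleton_prod_singleton, Measure.prod_prod, measure_singleton, zero_mul]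

lemma measurePreserving_conj :
    MeasurePreserving (fun z : ℂ => star z) stdComplexGaussian stdComplexGaussian := by
  refine ⟨by fun_prop, ?_⟩
  have : (fun z : ℂ => star z) = ((Complex.conjCLE : ℂ ≃L[ℝ] ℂ) : ℂ →L[ℝ] ℂ) := by
    ext z; simp
  rw [this]
  apply Measure.ext_of_charFunDual
  ext L
  rw [charFunDual_map, charFunDual_stdComplexGaussian, charFunDual_stdComplexGaussian]
  simp

/-- The law of a family of i.i.d. standard complex Gaussian variables. -/
noncomputable def gaussianPi (ι : Type*) [Fintype ι] : Measure (ι → ℂ) :=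
  Measure.pi fun _ => stdComplexGaussian

section gaussianPi

variable {ι κ : Type*} [Fintype ι] [Fintype κ]

instance : IsProbabilityMeasure (gaussianPi ι) := by
  unfold gaussianPi; infer_instance

lemma measurePreserving_gaussianPi_reindex (e : ι ≃ κ) :
    MeasurePreserving (fun (x : κ → ℂ) i => x (e i)) (gaussianPi κ) (gaussianPi ι) := by
  have h := (measurePreserving_piCongrLeft (fun _ : κ => stdComplexGaussian) e).symm
  exact h

lemma measurePreserving_gaussianPi_star :
    MeasurePreserving (fun (x : ι → ℂ) i => star (x i)) (gaussianPi ι) (gaussianPi ι) :=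
  measurePreserving_pi _ _ fun _ => measurePreserving_conj

lemma measurePreserving_gaussianPi_sumElim :
    MeasurePreserving (fun (x : (ι → ℂ) × (κ → ℂ)) => Sum.elim x.1 x.2)
      ((gaussianPi ι).prod (gaussianPi κ)) (gaussianPi (ι ⊕ κ)) :=
  measurePreserving_sumPiEquivProdPi_symm (X := fun _ : ι ⊕ κ => ℂ) fun _ => stdComplexGaussian

lemma charFunDual_gaussianPi [DecidableEq ι] (L : StrongDual ℝ (ι → ℂ)) :
    charFunDual (gaussianPi ι) L = Complex.exp (-((∑ i, (L (Pi.single i 1) ^ 2 +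
      L (Pi.single i Complex.I) ^ 2) : ℝ) : ℂ) / 4) := by
  rw [gaussianPi, charFunDual_pi]
  simp_rw [charFunDual_stdComplexGaussian]
  rw [← Complex.exp_sum, ← Finset.sum_div, Finset.sum_neg_distrib]
  simp

lemma sum_normSq_vecMul_unitary [DecidableEq ι] {U : Matrix ι ι ℂ}
    (hU : U ∈ Matrix.unitaryGroup ι ℂ) (c : ι → ℂ) :
    ∑ i, Complex.normSq ((c ᵥ* U) i) = ∑ i, Complex.normSq (c i) := by
  have key : ∀ d : ι → ℂ, ((∑ i, Complex.normSq (d i) : ℝ) : ℂ) = d ⬝ᵥ star d := by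
    intro d
    simp only [dotProduct, Pi.star_apply, Complex.ofReal_sum]
    exact Finset.sum_congr rfl fun i _ => (Complex.mul_conj _).symm
  apply Complex.ofReal_injective
  rw [key, key, Matrix.star_vecMul, ← Matrix.dotProduct_mulVec, Matrix.mulVec_mulVec,
    ← Matrix.star_eq_conjTranspose, Matrix.mem_unitaryGroup_iff.1 hU, Matrix.one_mulVec]

/-- The characteristic functional at `x ↦ Re (c ⬝ᵥ x)` depends only on the Euclidean norm of `c`,
and composing with `U` replaces `c` by `c ᵥ* U`, which has the same norm. -/
lemma measurePreserving_gaussianPi_mulVec [DecidableEq ι] {U : Matrix ι ι ℂ}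
    (hU : U ∈ Matrix.unitaryGroup ι ℂ) :
    MeasurePreserving (fun x : ι → ℂ => U *ᵥ x) (gaussianPi ι) (gaussianPi ι) := by
  let T : (ι → ℂ) →L[ℝ] (ι → ℂ) :=
    LinearMap.toContinuousLinearMap ((Matrix.mulVecLin U).restrictScalars ℝ)
  have hT : (fun x : ι → ℂ => U *ᵥ x) = T := rfl
  rw [hT]
  refine ⟨T.continuous.measurable, ?_⟩
  apply Measure.ext_of_charFunDual
  ext L
  rw [charFunDual_map, charFunDual_gaussianPi, charFunDual_gaussianPi]
  congr 4
  -- The minus sign is forced by `Re (c z) = c.re * z.re - c.im * z.im`.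
  let c : ι → ℂ := fun i => ⟨L (Pi.single i 1), -L (Pi.single i Complex.I)⟩
  have hL : ∀ x : ι → ℂ, L x = (c ⬝ᵥ x).re := by
    intro x
    have : x = ∑ i,
        ((x i).re • (Pi.single i 1 : ι → ℂ) + (x i).im • (Pi.single i Complex.I : ι → ℂ)) := by
      ext j
      simp only [Finset.sum_apply, Pi.add_apply, Pi.smul_apply, Complex.real_smul]
      rw [Finset.sum_eq_single j]
      · simp
      · intro b _ hb; simp [Pi.single_eq_of_ne' hb]
      · simp
    conv_lhs => rw [this]
    simp only [map_sum, map_add, map_smul, dotProduct, Complex.re_sum, Complex.mul_re, c]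
    refine Finset.sum_congr rfl fun i _ => ?_
    simp only [smul_eq_mul]
    ring
  have h1 : ∀ d : ι → ℂ, ∑ i, (((d ⬝ᵥ Pi.single i 1).re) ^ 2 +
      ((d ⬝ᵥ Pi.single i Complex.I).re) ^ 2) = ∑ i, Complex.normSq (d i) := by
    intro d
    refine Finset.sum_congr rfl fun i _ => ?_
    simp [Complex.normSq_apply]
    ring
  have h2 : ∀ x, L (T x) = ((c ᵥ* U) ⬝ᵥ x).re := by
    intro x
    rw [hL, ← hT, Matrix.dotProduct_mulVec]
  simp only [ContinuousLinearMap.comp_apply]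
  simp_rw [h2, hL]
  rw [h1, h1, sum_normSq_vecMul_unitary hU]

lemma measurePreserving_gaussianPi_unitary_mul [DecidableEq ι] {U : Matrix ι ι ℂ}
    (hU : U ∈ Matrix.unitaryGroup ι ℂ) :
    MeasurePreserving
      (fun (x : ι × κ → ℂ) p => (U * Matrix.of fun i j => x (i, j)) p.1 p.2)
      (gaussianPi (ι × κ)) (gaussianPi (ι × κ)) := by
  classical
  -- On the vector of all entries, left multiplication by `U` acts as the Kronecker product of `U`
  -- and the identity.
  have h := measurePreserving_gaussianPi_mulVec
    (Matrix.kronecker_mem_unitary hU (one_mem (Matrix.unitaryGroup κ ℂ)))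
  convert h using 3 with x p
  simp [Matrix.mulVec, dotProduct, Matrix.mul_apply, Fintype.sum_prod_type,
    Matrix.kroneckerMap_apply, Matrix.one_apply]

end gaussianPi

/-! ### Nonvanishing of polynomials and generic rank -/

/-- Induction with Fubini. View `p` as a polynomial in the first variable; its leading coefficient
is nonzero at almost every value of the others. What remains is a nonzero polynomial in one
variable, whose finitely many roots are null because `ν` has no atoms. -/
lemma ae_eval_ne_zero_fin (ν : Measure ℂ) [IsProbabilityMeasure ν] [NullSingletonClass ν] :
    ∀ (n : ℕ) (p : MvPolynomial (Fin n) ℂ), p ≠ 0 →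
      ∀ᵐ x ∂(Measure.pi fun _ : Fin n => ν), MvPolynomial.eval x p ≠ 0 := by
  intro n
  induction n with
  | zero =>
    intro p hp
    refine Filter.Eventually.of_forall fun x h => hp ?_
    rw [MvPolynomial.eq_C_of_isEmpty p] at h ⊢
    rw [MvPolynomial.eval_C] at h
    rw [h, map_zero]
  | succ n ih =>
    intro p hp
    have hq : MvPolynomial.finSuccEquiv ℂ n p ≠ 0 := by
      simpa using hp
    have hlc := ih _ (Polynomial.leadingCoeff_ne_zero.2 hq)
    have hmp := (measurePreserving_piFinSuccAbove (fun _ : Fin (n + 1) => ν) 0).symm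
    have hmeas : Measurable fun z : ℂ × (Fin n → ℂ) =>
        MvPolynomial.eval (Fin.cons z.1 z.2 : Fin (n + 1) → ℂ) p := by
      apply Continuous.measurable
      have hc : Continuous fun z : ℂ × (Fin n → ℂ) => (Fin.cons z.1 z.2 : Fin (n + 1) → ℂ) := by
        refine continuous_pi fun i => ?_
        refine Fin.cases ?_ (fun j => ?_) i
        · simpa using continuous_fst
        · simp only [Fin.cons_succ]
          fun_prop
      exact (MvPolynomial.continuous_eval p).comp hc
    have hset : MeasurableSet {z : (Fin n → ℂ) × ℂ |
        MvPolynomial.eval (Fin.cons z.2 z.1 : Fin (n + 1) → ℂ) p ≠ 0} :=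
      (hmeas.comp measurable_swap) (measurableSet_singleton 0).compl
    have h2 : ∀ᵐ z ∂((Measure.pi fun _ : Fin n => ν).prod ν),
        MvPolynomial.eval (Fin.cons z.2 z.1 : Fin (n + 1) → ℂ) p ≠ 0 := by
      refine (Measure.ae_prod_mem_iff_ae_ae_mem hset).2 ?_
      filter_upwards [hlc] with y hy
      have hne : Polynomial.map (MvPolynomial.eval y) (MvPolynomial.finSuccEquiv ℂ n p) ≠ 0 := by
        intro h0
        apply hy
        have := congrArg (fun r => Polynomial.coeff r
          (MvPolynomial.finSuccEquiv ℂ n p).natDegree) h0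
        simpa [Polynomial.coeff_map] using this
      have hfin := (Polynomial.map (MvPolynomial.eval y)
        (MvPolynomial.finSuccEquiv ℂ n p)).roots.toFinset.finite_toSet.measure_zero ν
      refine measure_mono_null ?_ hfin
      intro t ht
      simp only [Set.mem_compl_iff, Set.mem_ofPred_eq, not_not] at ht
      rw [MvPolynomial.eval_eq_eval_mv_eval'] at ht
      simp [hne, ht]
    rw [← Measure.prod_swap] at h2
    have h3 := ae_of_ae_map measurable_swap.aemeasurable h2
    filter_upwards [hmp.symm.quasiMeasurePreserving.ae h3] with x hx
    convert hx using 2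
    congr 1
    exact (Fin.cons_self_tail x).symm

lemma ae_eval_ne_zero {ι : Type*} [Fintype ι] {p : MvPolynomial ι ℂ} (hp : p ≠ 0) :
    ∀ᵐ x ∂(gaussianPi ι), MvPolynomial.eval x p ≠ 0 := by
  let e := Fintype.equivFin ι
  have h := ae_eval_ne_zero_fin stdComplexGaussian _ (MvPolynomial.rename e p)
    (by simpa using (MvPolynomial.rename_injective e e.injective).ne hp)
  have hmp := measurePreserving_gaussianPi_reindex e.symm
  filter_upwards [hmp.quasiMeasurePreserving.ae h] with x hx
  rw [MvPolynomial.eval_rename] at hx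
  rwa [show (fun i => x (e.symm i)) ∘ e = x by ext i; simp] at hx

/-- One maximal square minor suffices: its determinant is a nonzero polynomial in the entries. -/
lemma ae_rank_eq {ι κ : Type*} [Fintype ι] [Fintype κ] :
    ∀ᵐ x ∂(gaussianPi (ι × κ)), (Matrix.of fun i j => x (i, j)).rank =
      min (Fintype.card ι) (Fintype.card κ) := by
  set d := min (Fintype.card ι) (Fintype.card κ) with hd
  obtain ⟨f⟩ : Nonempty (Fin d ↪ ι) :=
    Function.Embedding.nonempty_of_card_le (by simp [hd])
  obtain ⟨g⟩ : Nonempty (Fin d ↪ κ) :=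
    Function.Embedding.nonempty_of_card_le (by simp [hd])
  have hp : MvPolynomial.rename (Prod.map f g)
      (Matrix.det (Matrix.mvPolynomialX (Fin d) (Fin d) ℂ)) ≠ 0 := by
    rw [Ne, map_eq_zero_iff _
      (MvPolynomial.rename_injective _ (f.injective.prodMap g.injective))]
    exact Matrix.det_mvPolynomialX_ne_zero (Fin d) ℂ
  filter_upwards [ae_eval_ne_zero hp] with x hx
  refine le_antisymm (le_min (Matrix.rank_le_card_height _) (Matrix.rank_le_card_width _)) ?_
  rw [MvPolynomial.eval_rename, ← MvPolynomial.coe_aeval_eq_eval, RingHom.coe_coe] at hx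
  have hdet : MvPolynomial.aeval (x ∘ Prod.map f g)
      (Matrix.det (Matrix.mvPolynomialX (Fin d) (Fin d) ℂ)) =
      ((Matrix.of fun i j => x (i, j)).submatrix f g).det := by
    rw [AlgHom.map_det]
    congr 1
    ext i j
    simp
  rw [hdet] at hx
  have hr := Matrix.rank_of_isUnit _ ((Matrix.isUnit_iff_isUnit_det _).2 (isUnit_iff_ne_zero.2 hx))
  rw [Fintype.card_fin] at hr
  rw [← hr]
  exact Matrix.rank_submatrix_le _ _ _

/-! ### Unitary completion of orthogonal columns -/

section Completion

variable {ι κ : Type*} [Fintype ι] [DecidableEq ι] [Fintype κ] [DecidableEq κ]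

/-- The nonzero columns of `M`, divided by `d j`, are orthonormal. Put the `j`-th at position `J j`,
extend to an orthonormal basis and take the adjoints of the basis vectors as the rows of `U`. -/
lemma exists_unitary_mul_eq {M : Matrix ι κ ℂ} {d : κ → ℝ}
    (hM : Mᴴ * M = Matrix.diagonal fun j => ((d j : ℂ) ^ 2)) {J : κ → ι}
    (hJ : Set.InjOn J {j | d j ≠ 0}) :
    ∃ U ∈ Matrix.unitaryGroup ι ℂ,
      U * M = Matrix.of fun i j => if i = J j then (d j : ℂ) else 0 := by
  classical
  have hM' : ∀ j k, ∑ l, star (M l j) * M l k = if j = k then (d j : ℂ) ^ 2 else 0 := by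
    intro j k
    have := congrFun (congrFun hM j) k
    simpa [Matrix.mul_apply, Matrix.diagonal_apply] using this
  let u : κ → EuclideanSpace ℂ ι := fun j => ((d j : ℂ)⁻¹) • WithLp.toLp 2 fun l => M l j
  have hinner : ∀ j k, inner ℂ (u j) (u k) =
      (d j : ℂ)⁻¹ * (d k : ℂ)⁻¹ * if j = k then (d j : ℂ) ^ 2 else 0 := by
    intro j k
    rw [← hM' j k, inner_smul_left, inner_smul_right, EuclideanSpace.inner_eq_star_dotProduct]
    simp only [dotProduct, Pi.star_apply, map_inv₀, Complex.conj_ofReal]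
    rw [mul_assoc]
    congr 2
    exact Finset.sum_congr rfl fun l _ => mul_comm _ _
  let s : Set ι := J '' {j | d j ≠ 0}
  -- The value `0` off `s` is arbitrary: only the restriction of `v` to `s` is extended to a basis.
  let v : ι → EuclideanSpace ℂ ι := fun i =>
    if h : ∃ j, d j ≠ 0 ∧ J j = i then u h.choose else 0
  have hv : ∀ j, d j ≠ 0 → v (J j) = u j := by
    intro j hj
    have h : ∃ k, d k ≠ 0 ∧ J k = J j := ⟨j, hj, rfl⟩
    have : h.choose = j := hJ h.choose_spec.1 hj h.choose_spec.2
    simp only [v, dif_pos h, this]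
  have horth : Orthonormal ℂ (s.domRestrict v) := by
    rw [orthonormal_iff_ite]
    rintro ⟨i, hi⟩ ⟨i', hi'⟩
    have hi₀ := hi
    have hi₁ := hi'
    obtain ⟨j, hj, rfl⟩ := hi₀
    obtain ⟨k, hk, rfl⟩ := hi₁
    have hsub : ((⟨J j, hi⟩ : s) = ⟨J k, hi'⟩) ↔ j = k :=
      ⟨fun h => hJ hj hk (congrArg Subtype.val h), fun h => by subst h; rfl⟩
    simp only [Set.domRestrict_apply, hv j hj, hv k hk, hinner, hsub]
    by_cases h : j = k
    · subst h
      have : (d j : ℂ) ≠ 0 := by exact_mod_cast hj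
      simp only [if_true]
      field_simp
    · rw [if_neg h, if_neg h, mul_zero]
  obtain ⟨b, hb⟩ := horth.exists_orthonormalBasis_extension_of_card_eq (by simp)
  refine ⟨Matrix.of fun i l => star (b i l), ?_, ?_⟩
  · rw [Matrix.mem_unitaryGroup_iff]
    ext i j
    have := orthonormal_iff_ite.1 b.orthonormal i j
    rw [EuclideanSpace.inner_eq_star_dotProduct] at this
    simpa [Matrix.mul_apply, Matrix.one_apply, Matrix.star_apply, dotProduct, mul_comm] using this
  · ext i j
    simp only [Matrix.mul_apply, Matrix.of_apply]
    by_cases hj : d j = 0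
    · have h0 : ∀ l, M l j = 0 := by
        have h := hM' j j
        rw [if_pos rfl, hj] at h
        have h2 : ∑ l, Complex.normSq (M l j) = 0 := by
          apply Complex.ofReal_injective
          simpa [Complex.normSq_eq_conj_mul_self] using h
        intro l
        have := (Finset.sum_eq_zero_iff_of_nonneg fun l _ => Complex.normSq_nonneg _).1 h2 l
          (Finset.mem_univ l)
        exact Complex.normSq_eq_zero.1 this
      simp [h0, hj]
    · have hbj : b (J j) = u j := by rw [hb _ ⟨j, hj, rfl⟩, hv j hj]
      have hdj : (d j : ℂ) ≠ 0 := by exact_mod_cast hj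
      have hcol : ∀ l, M l j = d j * b (J j) l := by
        intro l
        rw [hbj]
        simp only [u, PiLp.smul_apply, smul_eq_mul]
        field_simp
      have := orthonormal_iff_ite.1 b.orthonormal i (J j)
      rw [EuclideanSpace.inner_eq_star_dotProduct] at this
      simp only [dotProduct, Pi.star_apply] at this
      calc ∑ l, star (b i l) * M l j = d j * ∑ l, b (J j) l * star (b i l) := by
            rw [Finset.mul_sum]
            refine Finset.sum_congr rfl fun l _ => ?_
            rw [hcol]; ring
        _ = _ := by rw [this]; split_ifs <;> simp

open scoped ComplexOrder MatrixOrder in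
-- Writing `(DᴴD)⁻¹ = RᴴR`, the matrix `DRᴴ` has orthonormal columns. A unitary that sends them to
-- the basis vectors indexed by `J` turns the column projection of `D` into a coordinate projection.
lemma exists_unitary_projection_eq {D : Matrix ι κ ℂ} (hD : IsUnit (Dᴴ * D).det) {J : κ → ι}
    (hJ : J.Injective) :
    ∃ U ∈ Matrix.unitaryGroup ι ℂ,
      D * (Dᴴ * D)⁻¹ * Dᴴ = (U.submatrix J id)ᴴ * U.submatrix J id := by
  obtain ⟨R, hR⟩ := CStarAlgebra.nonneg_iff_eq_star_mul_self.1
    (Matrix.posSemidef_conjTranspose_mul_self D).inv.nonneg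
  rw [Matrix.star_eq_conjTranspose] at hR
  have hRS : R * ((Dᴴ * D) * Rᴴ) = 1 := by
    rw [mul_eq_one_comm, Matrix.mul_assoc, ← hR, Matrix.mul_nonsing_inv _ hD]
  have hM : (D * Rᴴ)ᴴ * (D * Rᴴ) = Matrix.diagonal fun _ => (((1 : ℝ) : ℂ) ^ 2) := by
    rw [Matrix.conjTranspose_mul, Matrix.conjTranspose_conjTranspose]
    simp only [Matrix.mul_assoc] at hRS ⊢
    rw [hRS]; simp
  obtain ⟨U, hU, hUM⟩ := exists_unitary_mul_eq hM (hJ.injOn (s := {j | (1 : ℝ) ≠ 0}))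
  refine ⟨U, hU, ?_⟩
  have hcol : D * Rᴴ = (U.submatrix J id)ᴴ := by
    have h1 : D * Rᴴ = Uᴴ * (U * (D * Rᴴ)) := by
      rw [← Matrix.mul_assoc Uᴴ, ← Matrix.star_eq_conjTranspose U,
        Matrix.mem_unitaryGroup_iff'.1 hU, Matrix.one_mul]
    rw [h1, hUM]
    ext l j
    simp [Matrix.mul_apply]
  have hcol' : R * Dᴴ = U.submatrix J id := by
    have := congrArg Matrix.conjTranspose hcol
    simpa [Matrix.conjTranspose_mul] using this
  rw [hR, ← hcol', Matrix.conjTranspose_mul]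
  simp [Matrix.mul_assoc]

end Completion

/-! ### Pencil determinants -/

section Pencil

variable {ι κ l : Type*} [Fintype ι] [DecidableEq ι] [Fintype κ] [DecidableEq κ]
  [Fintype l] [DecidableEq l]

/-- The normalized determinant `det (t S + T) / det S` of a matrix pencil. -/
noncomputable def pencilDet (S T : Matrix ι ι ℂ) (t : ℂ) : ℂ := (t • S + T).det / S.det

lemma pencilDet_eq {S T : Matrix ι ι ℂ} (hS : IsUnit S.det) (t : ℂ) :
    pencilDet S T t = (t • 1 + S⁻¹ * T).det := by
  rw [pencilDet, div_eq_iff hS.ne_zero, mul_comm, ← Matrix.det_mul, Matrix.mul_add,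
    Matrix.mul_smul, Matrix.mul_one, Matrix.mul_nonsing_inv_cancel_left _ _ hS]

/-- Sylvester's identity `det (1 + FG) = det (1 + GF)`, homogenised in `t`; the powers of `t` make
up for the different sizes. -/
lemma pow_card_mul_det_add_mul (F : Matrix ι κ ℂ) (G : Matrix κ ι ℂ) {t : ℂ} (ht : t ≠ 0) :
    t ^ Fintype.card κ * (t • 1 + F * G).det = t ^ Fintype.card ι * (t • 1 + G * F).det := by
  have h1 : (t • 1 + F * G) = t • (1 + (t⁻¹ • F) * G) := by
    rw [smul_add, Matrix.smul_mul, smul_smul, mul_inv_cancel₀ ht, one_smul]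
  have h2 : (t • 1 + G * F) = t • (1 + G * (t⁻¹ • F)) := by
    rw [smul_add, Matrix.mul_smul, smul_smul, mul_inv_cancel₀ ht, one_smul]
  rw [h1, h2, Matrix.det_smul, Matrix.det_smul, Matrix.det_one_add_mul_comm]
  ring

/-- The orthogonal projection onto the column space of a matrix of full column rank. -/
noncomputable def colProj (D : Matrix ι κ ℂ) : Matrix ι ι ℂ := D * (Dᴴ * D)⁻¹ * Dᴴ

omit [DecidableEq ι] in
-- With `F = (BᴴB)⁻¹BᴴD` and `G = (DᴴD)⁻¹DᴴB`, the two pencils are `t + FG` and `t + GF`. This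
-- symmetry is what exchanges `B` and `D` in the duality.
lemma pow_mul_pencilDet_colProj {B : Matrix ι κ ℂ} {D : Matrix ι l ℂ}
    (hB : IsUnit (Bᴴ * B).det) (hD : IsUnit (Dᴴ * D).det) {t : ℂ} (ht : t ≠ 0) :
    t ^ Fintype.card l * pencilDet (Bᴴ * B) (Bᴴ * colProj D * B) t =
      t ^ Fintype.card κ * pencilDet (Dᴴ * D) (Dᴴ * colProj B * D) t := by
  rw [pencilDet_eq hB, pencilDet_eq hD, colProj, colProj]
  have := pow_card_mul_det_add_mul ((Bᴴ * B)⁻¹ * Bᴴ * D) ((Dᴴ * D)⁻¹ * Dᴴ * B) ht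
  simp only [Matrix.mul_assoc] at this ⊢
  exact this

end Pencil

/-! ### The distributional identity for pencils of Gaussian matrices -/

/-- If the conditional law given `y` is almost surely the same `ρ`, then the unconditional law is
`ρ`; this allows an auxiliary independent matrix to be added. -/
lemma map_prod_eq_of_ae_map_eq {X Y T : Type*} [MeasurableSpace X] [MeasurableSpace Y]
    [MeasurableSpace T] {μ : Measure X} {ν : Measure Y} [SFinite μ] [IsProbabilityMeasure ν]
    {ρ : Measure T} {Φ : X × Y → T} (hΦ : Measurable Φ)
    (h : ∀ᵐ y ∂ν, μ.map (fun x => Φ (x, y)) = ρ) : (μ.prod ν).map Φ = ρ := by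
  ext s hs
  rw [Measure.map_apply hΦ hs, Measure.prod_apply_symm (hΦ hs)]
  have : ∀ᵐ y ∂ν, μ ((fun x => (x, y)) ⁻¹' (Φ ⁻¹' s)) = ρ s := by
    filter_upwards [h] with y hy
    have hm : Measurable fun x => Φ (x, y) := hΦ.comp measurable_prodMk_right
    rw [← hy, Measure.map_apply hm hs]
    rfl
  rw [lintegral_congr_ae this]
  simp

lemma Matrix.isUnit_det_of_rank_eq_card {κ : Type*} [Fintype κ] [DecidableEq κ]
    {M : Matrix κ κ ℂ} (h : M.rank = Fintype.card κ) : IsUnit M.det := by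
  rw [← Matrix.isUnit_iff_isUnit_det, ← Matrix.mulVec_surjective_iff_isUnit]
  have : LinearMap.range M.mulVecLin = ⊤ := by
    apply Submodule.eq_top_of_finrank_eq
    rw [← Matrix.rank, h, Module.finrank_fintype_fun_eq_card]
  exact LinearMap.range_eq_top.1 this

open scoped ComplexOrder in
lemma Matrix.isUnit_det_conjTranspose_mul_self {ι κ : Type*} [Fintype ι] [Fintype κ]
    [DecidableEq κ] {M : Matrix ι κ ℂ} (h : M.rank = Fintype.card κ) : IsUnit (Mᴴ * M).det :=
  Matrix.isUnit_det_of_rank_eq_card (by rw [Matrix.rank_conjTranspose_mul_self, h])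

section Link

variable {N n q : Type*} [Fintype N] [DecidableEq N] [Fintype n] [DecidableEq n]
  [Fintype q] [DecidableEq q]

/-- The matrix with a given family of entries. -/
def toMat {ι κ : Type*} (x : ι × κ → ℂ) : Matrix ι κ ℂ := Matrix.of fun i j => x (i, j)

@[fun_prop]
lemma continuous_toMat {ι κ : Type*} :
    Continuous (toMat : (ι × κ → ℂ) → Matrix ι κ ℂ) :=
  continuous_matrix fun i j => continuous_apply (i, j)

omit [DecidableEq N] in
lemma ae_isUnit_det_gram (h : Fintype.card n ≤ Fintype.card N) :
    ∀ᵐ x ∂(gaussianPi (N × n)), IsUnit ((toMat x)ᴴ * toMat x).det := by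
  filter_upwards [ae_rank_eq (ι := N) (κ := n)] with x hx
  exact Matrix.isUnit_det_conjTranspose_mul_self (by rw [toMat, hx, min_eq_right h])

lemma Continuous.measurable_pencilDet {X : Type*} [TopologicalSpace X] [MeasurableSpace X]
    [OpensMeasurableSpace X] {S T : X → Matrix n n ℂ} (hS : Continuous S) (hT : Continuous T)
    (t : ℂ) : Measurable fun x => pencilDet (S x) (T x) t :=
  ((hS.const_smul t).add hT).matrix_det.measurable.div hS.matrix_det.measurable

omit [DecidableEq N] in
lemma measurable_pencilDet_colProj (t : ℂ) :
    Measurable fun z : (N × n → ℂ) × (N × q → ℂ) =>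
      pencilDet ((toMat z.1)ᴴ * toMat z.1) ((toMat z.1)ᴴ * colProj (toMat z.2) * toMat z.1) t := by
  -- The coordinate `w.1` stands for the inverse determinant in `M⁻¹ = (det M)⁻¹ • adjugate M`. Once
  -- it is a free variable, both matrices of the pencil depend continuously on `w`.
  have hc : Measurable fun w : ℂ × ((N × n → ℂ) × (N × q → ℂ)) =>
      pencilDet ((toMat w.2.1)ᴴ * toMat w.2.1) ((toMat w.2.1)ᴴ *
        (toMat w.2.2 * (w.1 • ((toMat w.2.2)ᴴ * toMat w.2.2).adjugate) * (toMat w.2.2)ᴴ) *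
          toMat w.2.1) t := by
    have h1 : Continuous fun w : ℂ × ((N × n → ℂ) × (N × q → ℂ)) => toMat w.2.1 :=
      continuous_toMat.comp (by fun_prop)
    have h2 : Continuous fun w : ℂ × ((N × n → ℂ) × (N × q → ℂ)) => toMat w.2.2 :=
      continuous_toMat.comp (by fun_prop)
    refine Continuous.measurable_pencilDet (h1.matrix_conjTranspose.matrix_mul h1) ?_ t
    exact (h1.matrix_conjTranspose.matrix_mul ((h2.matrix_mul
      (continuous_fst.smul (h2.matrix_conjTranspose.matrix_mul h2).matrix_adjugate)).matrix_mul
        h2.matrix_conjTranspose)).matrix_mul h1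
  have h3 : Measurable fun z : (N × n → ℂ) × (N × q → ℂ) =>
      (((toMat z.2)ᴴ * toMat z.2).det⁻¹, z) := by
    have h2 : Continuous fun z : (N × n → ℂ) × (N × q → ℂ) => toMat z.2 :=
      continuous_toMat.comp (by fun_prop)
    exact (h2.matrix_conjTranspose.matrix_mul h2).matrix_det.measurable.inv.prodMk measurable_id
  convert hc.comp h3 using 2 with z
  simp only [Function.comp, colProj, Matrix.inv_def, Ring.inverse_eq_inv']

/-- The values at positive integers of the normalized pencil determinant of the Gram matrices of
`B` and of its rows selected by `J`. -/
noncomputable def gramPencil (J : q → N) (c : ℕ) (B : Matrix N n ℂ) (k : ℕ) : ℂ :=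
  ((k : ℂ) + 1) ^ c *
    pencilDet (Bᴴ * B) ((B.submatrix J id)ᴴ * B.submatrix J id) ((k : ℂ) + 1)

omit [DecidableEq N] [DecidableEq q] in
lemma measurable_gramPencil (J : q → N) (c : ℕ) :
    Measurable fun x : N × n → ℂ => gramPencil J c (toMat x) := by
  refine measurable_pi_lambda _ fun k => ?_
  have h := continuous_toMat (ι := N) (κ := n)
  have h' := h.matrix_submatrix J id
  exact measurable_const.mul (Continuous.measurable_pencilDet
    (h.matrix_conjTranspose.matrix_mul h) (h'.matrix_conjTranspose.matrix_mul h') _)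

/-- A unitary `U` carries the projection of the fixed matrix `D` to the selection of the rows `J`,
and the law of the Gaussian matrix is invariant under `U`. -/
lemma map_pencilDet_colProj {J : q → N} (hJ : J.Injective) {D : Matrix N q ℂ}
    (hD : IsUnit (Dᴴ * D).det) (c : ℕ) :
    (gaussianPi (N × n)).map (fun x (k : ℕ) => ((k : ℂ) + 1) ^ c *
      pencilDet ((toMat x)ᴴ * toMat x) ((toMat x)ᴴ * colProj D * toMat x) ((k : ℂ) + 1)) =
    (gaussianPi (N × n)).map fun x => gramPencil J c (toMat x) := by
  obtain ⟨U, hU, hUD⟩ := exists_unitary_projection_eq hD hJ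
  have hmp := measurePreserving_gaussianPi_unitary_mul (κ := n) hU
  conv_rhs => rw [← hmp.map_eq, Measure.map_map (measurable_gramPencil J c) hmp.measurable]
  congr 1
  ext x k
  have hx : toMat (fun p : N × n => (U * Matrix.of fun i j => x (i, j)) p.1 p.2) =
      U * toMat x := rfl
  have hsub : (U * toMat x).submatrix J id = U.submatrix J id * toMat x := by
    ext i j; rfl
  rw [Function.comp, gramPencil, hx, hsub, colProj, hUD, Matrix.conjTranspose_mul,
    Matrix.conjTranspose_mul]
  congr 2
  · rw [Matrix.mul_assoc, ← Matrix.mul_assoc Uᴴ, ← Matrix.star_eq_conjTranspose U,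
      Matrix.mem_unitaryGroup_iff'.1 hU, Matrix.one_mul]
  · simp only [Matrix.mul_assoc]

/-- Gaussian matrices `B` of size `N × n` and `D` of size `N × q` give rise to the same law of
pencil determinants, the rows being selected by `q → N` and `n → N` respectively. -/
theorem map_gramPencil_eq {J : q → N} (hJ : J.Injective) {K : n → N} (hK : K.Injective) :
    (gaussianPi (N × n)).map (fun x => gramPencil J (Fintype.card q) (toMat x)) =
      (gaussianPi (N × q)).map fun x => gramPencil K (Fintype.card n) (toMat x) := by
  have hcq := Fintype.card_le_of_injective J hJ
  have hcn := Fintype.card_le_of_injective K hK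
  have hq := ae_isUnit_det_gram (N := N) hcq
  have hn := ae_isUnit_det_gram (N := N) hcn
  let Φ : (N × n → ℂ) × (N × q → ℂ) → ℕ → ℂ := fun z k => ((k : ℂ) + 1) ^ Fintype.card q *
    pencilDet ((toMat z.1)ᴴ * toMat z.1) ((toMat z.1)ᴴ * colProj (toMat z.2) * toMat z.1)
      ((k : ℂ) + 1)
  let Ψ : (N × q → ℂ) × (N × n → ℂ) → ℕ → ℂ := fun z k => ((k : ℂ) + 1) ^ Fintype.card n *
    pencilDet ((toMat z.1)ᴴ * toMat z.1) ((toMat z.1)ᴴ * colProj (toMat z.2) * toMat z.1)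
      ((k : ℂ) + 1)
  have hΦ : Measurable Φ := measurable_pi_lambda _ fun k =>
    measurable_const.mul (measurable_pencilDet_colProj _)
  have hΨ : Measurable Ψ := measurable_pi_lambda _ fun k =>
    measurable_const.mul (measurable_pencilDet_colProj _)
  -- Both laws are realised on one product space: each row selection is replaced by the column
  -- projection of the other Gaussian matrix. The two functions then agree almost everywhere by the
  -- symmetry of the pencil.
  rw [← map_prod_eq_of_ae_map_eq (μ := gaussianPi (N × n)) (ν := gaussianPi (N × q)) hΦ
      (hq.mono fun y hy => map_pencilDet_colProj hJ hy _),
    ← map_prod_eq_of_ae_map_eq (μ := gaussianPi (N × q)) (ν := gaussianPi (N × n)) hΨ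
      (hn.mono fun y hy => map_pencilDet_colProj hK hy _),
    ← Measure.prod_swap (μ := gaussianPi (N × n)), Measure.map_map hΨ measurable_swap]
  refine Measure.map_congr ?_
  have h1 : ∀ᵐ z ∂((gaussianPi (N × n)).prod (gaussianPi (N × q))),
      IsUnit ((toMat z.1)ᴴ * toMat z.1).det := Measure.quasiMeasurePreserving_fst.ae hn
  have h2 : ∀ᵐ z ∂((gaussianPi (N × n)).prod (gaussianPi (N × q))),
      IsUnit ((toMat z.2)ᴴ * toMat z.2).det := Measure.quasiMeasurePreserving_snd.ae hq
  filter_upwards [h1, h2] with z hz1 hz2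
  ext k
  exact pow_mul_pencilDet_colProj hz1 hz2 (Nat.cast_add_one_ne_zero k)

end Link

/-! ### Existence of the generalized singular value decomposition -/

lemma Fin.iff_lt_of_card {n k : ℕ} {p : Fin n → Prop} [DecidablePred p]
    (hp : ∀ i j, i ≤ j → p j → p i) (hk : (Finset.univ.filter p).card = k) (i : Fin n) :
    p i ↔ (i : ℕ) < k := by
  constructor
  · intro h
    have : Finset.Iic i ⊆ Finset.univ.filter p := fun j hj => by
      simpa using hp j i (Finset.mem_Iic.1 hj) h
    have := Finset.card_le_card this
    rw [Fin.card_Iic, hk] at this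
    omega
  · intro h
    by_contra hi
    have : Finset.univ.filter p ⊆ Finset.Iio i := fun j hj => by
      simp only [Finset.mem_filter, Finset.mem_univ, true_and] at hj
      exact Finset.mem_Iio.2 (lt_of_not_ge fun hij => hi (hp i j hij hj))
    have := Finset.card_le_card this
    rw [Fin.card_Iio, hk] at this
    omega

/-! ### Ordered unitary diagonalisation and nonzero eigenvalues -/

section Spectral

variable {n : ℕ}

lemma Matrix.IsHermitian.exists_unitary_antitone {H : Matrix (Fin n) (Fin n) ℂ}
    (hH : H.IsHermitian) :
    ∃ W ∈ Matrix.unitaryGroup (Fin n) ℂ, ∃ a : Fin n → ℝ, Antitone a ∧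
      Wᴴ * H * W = Matrix.diagonal fun i => (a i : ℂ) := by
  let σ := Tuple.sort fun i => -hH.eigenvalues i
  have hσ : Monotone ((fun i => -hH.eigenvalues i) ∘ σ) := Tuple.monotone_sort _
  let V : Matrix (Fin n) (Fin n) ℂ := hH.eigenvectorUnitary
  have hV : V ∈ Matrix.unitaryGroup (Fin n) ℂ := hH.eigenvectorUnitary.2
  have hsub : ∀ M : Matrix (Fin n) (Fin n) ℂ,
      (V.submatrix id σ)ᴴ * M * V.submatrix id σ = (Vᴴ * M * V).submatrix σ σ := by
    intro M
    ext i j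
    simp [Matrix.mul_apply]
  refine ⟨V.submatrix id σ, ?_, hH.eigenvalues ∘ σ, fun i j hij => ?_, ?_⟩
  · rw [Matrix.mem_unitaryGroup_iff', Matrix.star_eq_conjTranspose]
    have := hsub 1
    rw [Matrix.mul_one, Matrix.mul_one, ← Matrix.star_eq_conjTranspose V,
      Matrix.mem_unitaryGroup_iff'.1 hV] at this
    rw [this]
    exact Matrix.submatrix_one_equiv σ
  · exact neg_le_neg_iff.1 (hσ hij)
  · have h := hH.conjStarAlgAut_star_eigenvectorUnitary
    rw [Unitary.conjStarAlgAut_star_apply] at h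
    have h' : Vᴴ * H * V = Matrix.diagonal fun i => (hH.eigenvalues i : ℂ) := h
    rw [hsub, h']
    ext i j
    simp [Matrix.diagonal_apply]

lemma Matrix.charpoly_eq_of_unitary_diagonalization {H W : Matrix (Fin n) (Fin n) ℂ}
    (hW : W ∈ Matrix.unitaryGroup (Fin n) ℂ) {a : Fin n → ℂ}
    (h : Wᴴ * H * W = Matrix.diagonal a) :
    H.charpoly = (Matrix.diagonal a).charpoly := by
  rw [← h, Matrix.mul_assoc, Matrix.charpoly_mul_comm, Matrix.mul_assoc,
    ← Matrix.star_eq_conjTranspose W, Matrix.mem_unitaryGroup_iff.1 hW, Matrix.mul_one]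

lemma Matrix.rank_eq_of_unitary_diagonalization {H W : Matrix (Fin n) (Fin n) ℂ}
    (hW : W ∈ Matrix.unitaryGroup (Fin n) ℂ) {a : Fin n → ℂ}
    (h : Wᴴ * H * W = Matrix.diagonal a) :
    H.rank = (Finset.univ.filter fun i => a i ≠ 0).card := by
  have hu : IsUnit W.det := (Matrix.isUnit_iff_isUnit_det _).1
    (isUnit_iff_exists.2 ⟨star W, Matrix.mem_unitaryGroup_iff.1 hW, Matrix.mem_unitaryGroup_iff'.1 hW⟩)
  have hu' : IsUnit (Wᴴ).det := by rw [Matrix.det_conjTranspose]; exact hu.star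
  have := congrArg Matrix.rank h
  rw [Matrix.rank_mul_eq_left_of_isUnit_det _ _ hu, Matrix.rank_mul_eq_right_of_isUnit_det _ _ hu',
    Matrix.rank_diagonal, Fintype.card_subtype] at this
  exact this

lemma nonzeroEigenvalues_of_unitary_diagonalization {H W : Matrix (Fin n) (Fin n) ℂ}
    (hW : W ∈ Matrix.unitaryGroup (Fin n) ℂ) {a : Fin n → ℂ}
    (h : Wᴴ * H * W = Matrix.diagonal a) :
    nonzeroEigenvalues H = (Finset.univ.filter fun i => a i ≠ 0).val.map a := by
  rw [nonzeroEigenvalues, Matrix.charpoly_eq_of_unitary_diagonalization hW h,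
    Matrix.charpoly_diagonal,
    Polynomial.roots_prod _ _ (Finset.prod_ne_zero_iff.2 fun i _ => Polynomial.X_sub_C_ne_zero _)]
  simp only [Polynomial.roots_X_sub_C, Multiset.bind_singleton, Multiset.filter_map]
  rfl

lemma isNonzeroEigenvalueTuple_of_unitary_diagonalization {s : ℕ} (hs : s ≤ n)
    {H W : Matrix (Fin n) (Fin n) ℂ} (hW : W ∈ Matrix.unitaryGroup (Fin n) ℂ) {a : Fin n → ℝ}
    (h : Wᴴ * H * W = Matrix.diagonal fun i => (a i : ℂ)) (ha : ∀ i, a i ≠ 0 ↔ (i : ℕ) < s) :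
    IsNonzeroEigenvalueTuple H fun i => a (Fin.castLE hs i) := by
  rw [IsNonzeroEigenvalueTuple, nonzeroEigenvalues_of_unitary_diagonalization hW h]
  have : (Finset.univ.filter fun i => (a i : ℂ) ≠ 0) = Finset.univ.map (Fin.castLEEmb hs) := by
    ext i
    simp only [ne_eq, Complex.ofReal_eq_zero, Finset.mem_filter, Finset.mem_univ, true_and,
      Finset.mem_map]
    rw [← ne_eq, ha]
    exact ⟨fun h => ⟨⟨i, h⟩, rfl⟩, fun ⟨j, hj⟩ => hj ▸ j.2⟩
  rw [this, Finset.map_val, Multiset.map_map]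
  rfl

end Spectral

/-! ### Zero padding and unitary factors of prescribed shape -/

section PadZero

variable {a b c d e f : ℕ}

lemma Fin.sum_dite_lt {R : Type*} [AddCommMonoid R] {b d : ℕ} (h : b ≤ d) (g : Fin b → R) :
    ∑ l : Fin d, (if hl : (l : ℕ) < b then g ⟨l, hl⟩ else 0) = ∑ l, g l := by
  obtain ⟨e, rfl⟩ := Nat.exists_eq_add_of_le h
  rw [Fin.sum_univ_add]
  simp

lemma padZero_mul_padZero (h : b ≤ d) (M : Matrix (Fin a) (Fin b) ℂ)
    (N : Matrix (Fin b) (Fin c) ℂ) :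
    padZero e d M * padZero d f N = padZero e f (M * N) := by
  ext i j
  simp only [Matrix.mul_apply, padZero, Matrix.of_apply]
  by_cases hi : (i : ℕ) < a
  · by_cases hj : (j : ℕ) < c
    · rw [dif_pos ⟨hi, hj⟩, ← Fin.sum_dite_lt h]
      refine Finset.sum_congr rfl fun l _ => ?_
      by_cases hl : (l : ℕ) < b <;> simp [hi, hj, hl]
    · simp [hj]
  · simp [hi]

lemma padZero_self (M : Matrix (Fin a) (Fin b) ℂ) : padZero a b M = M := by
  ext i j
  simp [padZero]

lemma rank_padZero_le (d : ℕ) (M : Matrix (Fin a) (Fin b) ℂ) :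
    (padZero a d M).rank ≤ M.rank := by
  have h1 : padZero a d M = M * padZero b d (1 : Matrix (Fin b) (Fin b) ℂ) := by
    conv_rhs => rw [← padZero_self M]
    rw [padZero_mul_padZero le_rfl, Matrix.mul_one]
  rw [h1]
  exact Matrix.rank_mul_le_left _ _

end PadZero

/-- Here the target position is a partial matching `p`, since columns with `d j = 0` may have no row
to go to, as when `k > m`. -/
lemma exists_unitary_mul_eq_of_rel {m k : ℕ} {M : Matrix (Fin m) (Fin k) ℂ} {d : Fin k → ℝ}
    (hM : Mᴴ * M = Matrix.diagonal fun j => ((d j : ℂ) ^ 2)) (p : Fin m → Fin k → Prop)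
    [∀ i j, Decidable (p i j)] (hp : ∀ j, d j ≠ 0 → ∃ i, p i j)
    (hp₁ : ∀ i i' j, p i j → p i' j → i = i') (hp₂ : ∀ i j j', p i j → p i j' → j = j') :
    ∃ U ∈ Matrix.unitaryGroup (Fin m) ℂ,
      U * M = Matrix.of fun i j => if p i j then (d j : ℂ) else 0 := by
  classical
  -- A default row is needed for the unmatched columns, so `m = 0` is treated apart.
  rcases Nat.eq_zero_or_pos m with rfl | hm
  · exact ⟨1, one_mem _, by ext i; exact i.elim0⟩
  let J : Fin k → Fin m := fun j => if h : ∃ i, p i j then h.choose else ⟨0, hm⟩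
  have hJ : ∀ j, d j ≠ 0 → p (J j) j := by
    intro j hj
    simp only [J, dif_pos (hp j hj)]
    exact (hp j hj).choose_spec
  obtain ⟨U, hU, hUM⟩ := exists_unitary_mul_eq (J := J) hM fun j hj j' hj' h =>
    hp₂ (J j) j j' (hJ j hj) (h ▸ hJ j' hj')
  refine ⟨U, hU, ?_⟩
  rw [hUM]
  ext i j
  simp only [Matrix.of_apply]
  by_cases hj : d j = 0
  · simp [hj]
  · have : i = J j ↔ p i j := ⟨fun h => h ▸ hJ j hj, fun h => hp₁ _ _ _ h (hJ j hj)⟩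
    simp only [this]

lemma gram_fromRows {m n q : ℕ} (A : Matrix (Fin m) (Fin n) ℂ) (C : Matrix (Fin q) (Fin n) ℂ) :
    (Matrix.fromRows A C)ᴴ * Matrix.fromRows A C = Aᴴ * A + Cᴴ * C := by
  rw [Matrix.conjTranspose_fromRows_eq_fromCols_conjTranspose, Matrix.fromCols_mul_fromRows]

open scoped ComplexOrder in
lemma nonneg_of_gram_eq_diagonal {ι κ : Type*} [Fintype ι] [Fintype κ] [DecidableEq κ]
    {M : Matrix ι κ ℂ} {a : κ → ℝ} (h : Mᴴ * M = Matrix.diagonal fun i => (a i : ℂ)) (i : κ) :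
    0 ≤ a i := by
  have h1 := (Matrix.posSemidef_conjTranspose_mul_self M).diag_nonneg (i := i)
  rw [h, Matrix.diagonal_apply_eq] at h1
  exact_mod_cast h1

open scoped ComplexOrder in
-- After whitening, the CS decomposition: two positive semidefinite Gram matrices with sum `1` are
-- diagonalised together, with eigenvalues `c i` and `1 - c i`. The decreasing order of `c` produces
-- the blocks `1`, `α`, `0`, whose sizes are counted by the ranks.
theorem nonempty_GSVD {m n q : ℕ} (A : Matrix (Fin m) (Fin n) ℂ) (C : Matrix (Fin q) (Fin n) ℂ)
    {k r s : ℕ} (hk : (Matrix.fromRows A C).rank = k)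
    (hr : r + C.rank = (Matrix.fromRows A C).rank)
    (hs : s + (Matrix.fromRows A C).rank = A.rank + C.rank) :
    Nonempty (GSVD A C k r s) := by
  classical
  set B := Matrix.fromRows A C with hB
  have hkn : k ≤ n := by
    rw [← hk]; simpa using Matrix.rank_le_card_width B
  obtain ⟨Q', hQ', a, ha, hdiag⟩ :=
    (Matrix.isHermitian_conjTranspose_mul_self B).exists_unitary_antitone
  have hQ'u : IsUnit Q'.det := (Matrix.isUnit_iff_isUnit_det _).1
    (isUnit_iff_exists.2 ⟨star Q', Matrix.mem_unitaryGroup_iff.1 hQ',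
      Matrix.mem_unitaryGroup_iff'.1 hQ'⟩)
  have ha0 : ∀ i, 0 ≤ a i := nonneg_of_gram_eq_diagonal (M := B * Q') (by
    rw [← hdiag, Matrix.conjTranspose_mul]; simp only [Matrix.mul_assoc])
  have hak : ∀ i, a i ≠ 0 ↔ (i : ℕ) < k := by
    refine Fin.iff_lt_of_card (fun i j hij hj => ?_) ?_
    · exact ((lt_of_le_of_ne (ha0 j) (Ne.symm hj)).trans_le (ha hij)).ne'
    · have h := Matrix.rank_eq_of_unitary_diagonalization hQ' hdiag
      rw [Matrix.rank_conjTranspose_mul_self, hk] at h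
      rw [h]; simp
  let ι : Fin k → Fin n := Fin.castLE hkn
  let ρ : Fin k → ℝ := fun i => √(a (ι i))
  have hρ : ∀ i, (ρ i : ℂ) ≠ 0 := fun i => by
    have h1 : a (ι i) ≠ 0 := (hak _).2 i.2
    exact_mod_cast (Real.sqrt_ne_zero (ha0 _)).2 h1
  have hρ2 : ∀ i, ρ i ^ 2 = a (ι i) := fun i => Real.sq_sqrt (ha0 _)
  -- `E` consists of the eigenvectors of `BᴴB` with nonzero eigenvalue and `R'` is the inverse of
  -- `R`, so that `B * E * R'` has orthonormal columns.
  let E : Matrix (Fin n) (Fin k) ℂ := Q'.submatrix id ι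
  let R' : Matrix (Fin k) (Fin k) ℂ := Matrix.diagonal fun i => (ρ i : ℂ)⁻¹
  have hsumQ : (A * Q')ᴴ * (A * Q') + (C * Q')ᴴ * (C * Q') =
      Matrix.diagonal fun i => (a i : ℂ) := by
    rw [← hdiag, hB, gram_fromRows, Matrix.conjTranspose_mul, Matrix.conjTranspose_mul]
    simp only [Matrix.mul_add, Matrix.add_mul, Matrix.mul_assoc]
  -- A column of `B * Q'` with eigenvalue `0` has norm zero, hence so do its `A`-part and its
  -- `C`-part.
  have hzero : ∀ j : Fin n, ¬ (j : ℕ) < k → (∀ i, (A * Q') i j = 0) ∧ ∀ i, (C * Q') i j = 0 := by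
    intro j hj
    have haj : a j = 0 := by by_contra h; exact hj ((hak j).1 h)
    have h := congrFun (congrFun hsumQ j) j
    rw [Matrix.diagonal_apply_eq, haj, Matrix.add_apply, Matrix.mul_apply, Matrix.mul_apply] at h
    have h2 : ∑ i, Complex.normSq ((A * Q') i j) + ∑ i, Complex.normSq ((C * Q') i j) = 0 := by
      apply Complex.ofReal_injective
      simpa [Complex.normSq_eq_conj_mul_self] using h
    have hA0 : 0 ≤ ∑ i, Complex.normSq ((A * Q') i j) :=
      Finset.sum_nonneg fun _ _ => Complex.normSq_nonneg _
    have hC0 : 0 ≤ ∑ i, Complex.normSq ((C * Q') i j) :=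
      Finset.sum_nonneg fun _ _ => Complex.normSq_nonneg _
    have hA1 : ∑ i, Complex.normSq ((A * Q') i j) = 0 := by linarith
    have hC1 : ∑ i, Complex.normSq ((C * Q') i j) = 0 := by linarith
    exact ⟨fun i => Complex.normSq_eq_zero.1 ((Finset.sum_eq_zero_iff_of_nonneg
        fun l _ => Complex.normSq_nonneg _).1 hA1 i (Finset.mem_univ i)),
      fun i => Complex.normSq_eq_zero.1 ((Finset.sum_eq_zero_iff_of_nonneg
        fun l _ => Complex.normSq_nonneg _).1 hC1 i (Finset.mem_univ i))⟩
  have hpad : ∀ {l : ℕ} (M : Matrix (Fin l) (Fin n) ℂ),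
      (∀ j : Fin n, ¬ (j : ℕ) < k → ∀ i, (M * Q') i j = 0) → M * Q' = padZero l n (M * E) := by
    intro l M h
    ext i j
    by_cases hj : (j : ℕ) < k
    · simp [padZero, hj, Matrix.mul_apply, E, ι]
    · simp [padZero, hj, h j hj i]
  have hpadA := hpad A fun j hj => (hzero j hj).1
  have hpadC := hpad C fun j hj => (hzero j hj).2
  have hE : (A * E)ᴴ * (A * E) + (C * E)ᴴ * (C * E) =
      Matrix.diagonal fun i => (ρ i : ℂ) ^ 2 := by
    ext i j
    have h := congrFun (congrFun hsumQ (ι i)) (ι j)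
    have h3 : ∀ {l : ℕ} (M : Matrix (Fin l) (Fin n) ℂ),
        ((M * E)ᴴ * (M * E)) i j = ((M * Q')ᴴ * (M * Q')) (ι i) (ι j) := by
      intro l M
      simp [Matrix.mul_apply, E]
    rw [Matrix.add_apply, h3, h3, ← Matrix.add_apply, h]
    have hinj : ι i = ι j ↔ i = j := (Fin.castLE_injective hkn).eq_iff
    simp only [Matrix.diagonal_apply, hinj]
    rw [← hρ2]
    push_cast
    rfl
  have hR'ct : R'ᴴ = R' := by
    simp only [R', Matrix.diagonal_conjTranspose]
    congr 1
    ext i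
    simp
  have hone : (A * E * R')ᴴ * (A * E * R') + (C * E * R')ᴴ * (C * E * R') = 1 := by
    have : (A * E * R')ᴴ * (A * E * R') + (C * E * R')ᴴ * (C * E * R') =
        R' * ((A * E)ᴴ * (A * E) + (C * E)ᴴ * (C * E)) * R' := by
      rw [Matrix.conjTranspose_mul (A * E), Matrix.conjTranspose_mul (C * E), hR'ct]
      simp only [Matrix.mul_add, Matrix.add_mul, Matrix.mul_assoc]
    rw [this, hE]
    simp only [R', Matrix.diagonal_mul_diagonal]
    rw [← Matrix.diagonal_one]
    congr 1
    ext i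
    have := hρ i
    field_simp
  obtain ⟨W, hW, c, hc, hWdiag⟩ :=
    (Matrix.isHermitian_conjTranspose_mul_self (A * E * R')).exists_unitary_antitone
  have hWu : Wᴴ * W = 1 := Matrix.mem_unitaryGroup_iff'.1 hW
  have hM1 : (A * E * R' * W)ᴴ * (A * E * R' * W) = Matrix.diagonal fun i => (c i : ℂ) := by
    rw [← hWdiag, Matrix.conjTranspose_mul _ W]; simp only [Matrix.mul_assoc]
  have hWdiag2 : Wᴴ * ((C * E * R')ᴴ * (C * E * R')) * W =
      Matrix.diagonal fun i => ((1 - c i : ℝ) : ℂ) := by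
    rw [eq_sub_of_add_eq' hone, Matrix.mul_sub, Matrix.sub_mul, hWdiag, Matrix.mul_one, hWu,
      ← Matrix.diagonal_one, Matrix.diagonal_sub]
    congr 1
    ext i
    push_cast
    rfl
  have hM2 : (C * E * R' * W)ᴴ * (C * E * R' * W) =
      Matrix.diagonal fun i => ((1 - c i : ℝ) : ℂ) := by
    rw [← hWdiag2, Matrix.conjTranspose_mul _ W]; simp only [Matrix.mul_assoc]
  have hc0 := nonneg_of_gram_eq_diagonal hM1
  have hc1 := nonneg_of_gram_eq_diagonal hM2
  have hR'u : IsUnit R'.det := by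
    rw [Matrix.det_diagonal]
    exact isUnit_iff_ne_zero.2 (Finset.prod_ne_zero_iff.2 fun i _ => inv_ne_zero (hρ i))
  have hrank : ∀ {l : ℕ} (M : Matrix (Fin l) (Fin n) ℂ), M * Q' = padZero l n (M * E) →
      (M * E * R').rank = M.rank := by
    intro l M h
    rw [Matrix.rank_mul_eq_left_of_isUnit_det _ _ hR'u]
    refine le_antisymm (Matrix.rank_mul_le_left _ _) ?_
    rw [← Matrix.rank_mul_eq_left_of_isUnit_det Q' M hQ'u, h]
    exact rank_padZero_le n _
  have hcardA : (Finset.univ.filter fun i => c i ≠ 0).card = A.rank := by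
    have h := Matrix.rank_eq_of_unitary_diagonalization hW hWdiag
    rw [Matrix.rank_conjTranspose_mul_self, hrank A hpadA] at h
    rw [h]; simp
  have hcardC : (Finset.univ.filter fun i => c i ≠ 1).card = C.rank := by
    have h := Matrix.rank_eq_of_unitary_diagonalization hW hWdiag2
    rw [Matrix.rank_conjTranspose_mul_self, hrank C hpadC] at h
    rw [h]
    congr 1
    ext i
    simp only [Finset.mem_filter, Finset.mem_univ, true_and, ne_eq, Complex.ofReal_eq_zero]
    rw [sub_eq_zero, eq_comm]
  have hcA : ∀ i, c i ≠ 0 ↔ (i : ℕ) < A.rank := by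
    refine Fin.iff_lt_of_card (fun i j hij hj => ?_) hcardA
    exact ((lt_of_le_of_ne (hc0 j) (Ne.symm hj)).trans_le (hc hij)).ne'
  -- The indices with `c i ≠ 1` number `rank C`, which leaves `k - rank C = r` leading ones.
  have hcr : ∀ i, c i = 1 ↔ (i : ℕ) < r := by
    refine Fin.iff_lt_of_card (fun i j hij hj => ?_) ?_
    · exact le_antisymm (by linarith [hc1 i]) (hj ▸ hc hij)
    · have h := Finset.card_filter_add_card_filter_not (s := (Finset.univ : Finset (Fin k)))
        (fun i => c i = 1)
      simp only [Finset.card_univ, Fintype.card_fin] at h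
      have hcardC' : (Finset.univ.filter fun i => ¬ c i = 1).card = C.rank := hcardC
      omega
  have hAk : A.rank ≤ k := by
    rw [← hcardA]; simpa using Finset.card_le_univ (Finset.univ.filter fun i => c i ≠ 0)
  have hAm : A.rank ≤ m := Matrix.rank_le_height A
  have hCq : C.rank ≤ q := Matrix.rank_le_height C
  have hsr : r + s = A.rank := by omega
  obtain ⟨U, hU, hUM⟩ := exists_unitary_mul_eq_of_rel (M := A * E * R' * W) (d := fun j => √(c j))
    (by rw [hM1]; congr 1; ext j; exact_mod_cast (Real.sq_sqrt (hc0 j)).symm)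
    (fun i j => (i : ℕ) = j)
    (fun j hj => by
      have : (j : ℕ) < A.rank := (hcA j).1 ((Real.sqrt_ne_zero (hc0 j)).1 hj)
      exact ⟨⟨j, by omega⟩, rfl⟩)
    (fun i i' j h h' => Fin.ext (by omega)) (fun i j j' h h' => Fin.ext (by omega))
  -- The diagonal of `Σ_C` is anchored at the lower right corner. A row `q + j - k` exists for every
  -- `j ≥ r` because `k - r = rank C ≤ q`.
  obtain ⟨V, hV, hVM⟩ := exists_unitary_mul_eq_of_rel (M := C * E * R' * W)
    (d := fun j => √(1 - c j))
    (by rw [hM2]; congr 1; ext j; exact_mod_cast (Real.sq_sqrt (hc1 j)).symm)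
    (fun i j => (i : ℕ) + k = q + j)
    (fun j hj => by
      have h1 : ¬ (j : ℕ) < r := fun h => by
        simp [(hcr j).2 h] at hj
      have := j.2
      exact ⟨⟨q + j - k, by omega⟩, show q + (j : ℕ) - k + k = q + j by omega⟩)
    (fun i i' j h h' => Fin.ext (by omega)) (fun i j j' h h' => Fin.ext (by omega))
  let idx : Fin s → Fin k := fun i => ⟨r + i, by omega⟩
  have hidx : ∀ (j : Fin k) (hjr : ¬ (j : ℕ) < r) (h : (j : ℕ) - r < s), idx ⟨j - r, h⟩ = j := by
    intro j hjr h
    exact Fin.ext (show r + ((j : ℕ) - r) = j by omega)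
  have hinv : (Wᴴ * Matrix.diagonal (fun i => (ρ i : ℂ)))⁻¹ = R' * W := by
    apply Matrix.inv_eq_right_inv
    have h1 : Matrix.diagonal (fun i => (ρ i : ℂ)) * R' = 1 := by
      simp only [R', Matrix.diagonal_mul_diagonal]
      rw [← Matrix.diagonal_one]
      congr 1
      ext i
      exact mul_inv_cancel₀ (hρ i)
    rw [Matrix.mul_assoc, ← Matrix.mul_assoc _ R', h1, Matrix.one_mul, hWu]
  have hfactor : ∀ {l : ℕ} (M : Matrix (Fin l) (Fin n) ℂ) (X : Matrix (Fin l) (Fin l) ℂ),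
      M * Q' = padZero l n (M * E) →
      X * M * (Q' * padZero n n (Wᴴ * Matrix.diagonal (fun i => (ρ i : ℂ)))⁻¹) =
        padZero l n (X * (M * E * R' * W)) := by
    intro l M X h
    rw [Matrix.mul_assoc, ← Matrix.mul_assoc M, h, hinv, padZero_mul_padZero hkn]
    conv_lhs => rw [← padZero_self X]
    rw [padZero_mul_padZero le_rfl]
    simp only [Matrix.mul_assoc]
  refine ⟨{
    U := U, V := V, Q := Q' * padZero n n (Wᴴ * Matrix.diagonal (fun i => (ρ i : ℂ)))⁻¹
    Q' := Q', W := W, ρ := ρ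
    α := fun i => √(c (idx i)), β := fun i => √(1 - c (idx i))
    rank_k := hk, rank_r := hr, rank_s := hs
    U_unitary := hU, V_unitary := hV, Q'_unitary := hQ', W_unitary := hW
    ρ_nonneg := fun i => Real.sqrt_nonneg _
    ρ_spec := ?_
    Q_eq := rfl
    α_nonneg := fun i => Real.sqrt_nonneg _
    β_nonneg := fun i => Real.sqrt_nonneg _
    sq_add_sq := fun i => by rw [Real.sq_sqrt (hc0 _), Real.sq_sqrt (hc1 _)]; ring
    factor_A := ?_
    factor_C := ?_ }⟩
  · simp only [hρ2]
    exact isNonzeroEigenvalueTuple_of_unitary_diagonalization hkn hQ' hdiag hak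
  · rw [hfactor A U hpadA, hUM]
    congr 1
    ext i j
    simp only [sigmaA, Matrix.of_apply]
    by_cases hij : (i : ℕ) = j
    · rw [if_pos hij, if_pos hij]
      by_cases hjr : (j : ℕ) < r
      · rw [if_pos hjr, (hcr j).2 hjr]; simp
      · rw [if_neg hjr]
        by_cases h : (j : ℕ) - r < s
        · rw [dif_pos h, hidx j hjr h]
        · rw [dif_neg h]
          have : c j = 0 := by
            by_contra h'
            have := (hcA j).1 h'
            omega
          simp [this]
    · rw [if_neg hij, if_neg hij]
  · rw [hfactor C V hpadC, hVM]
    congr 1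
    ext i j
    simp only [sigmaC, Matrix.of_apply]
    by_cases hij : (i : ℕ) + k = q + j
    · rw [if_pos hij, if_pos hij]
      by_cases hjr : (j : ℕ) < r
      · rw [if_pos hjr, (hcr j).2 hjr]; simp
      · rw [if_neg hjr]
        by_cases h : (j : ℕ) - r < s
        · rw [dif_pos h, hidx j hjr h]
        · rw [dif_neg h]
          have : c j = 0 := by
            by_contra h'
            have := (hcA j).1 h'
            omega
          simp [this]
    · rw [if_neg hij, if_neg hij]

/-! ### Determinantal description of the generalized singular values -/

/-- The values at the positive integers of the monic polynomial with roots `-1 / (1 + v i)`. -/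
noncomputable def tuplePoly {s : ℕ} (v : Fin s → ℝ) (k : ℕ) : ℂ :=
  ∏ i, ((k : ℂ) + 1 + ((1 + v i)⁻¹ : ℝ))

lemma gram_of_rel {m k : ℕ} (p : Fin m → Fin k → Prop) [∀ i j, Decidable (p i j)] (d : Fin k → ℝ)
    (hp : ∀ j, d j ≠ 0 → ∃ i, p i j)
    (hp₁ : ∀ i i' j, p i j → p i' j → i = i') (hp₂ : ∀ i j j', p i j → p i j' → j = j')
    {M : Matrix (Fin m) (Fin k) ℂ}
    (hM : M = Matrix.of fun i j => if p i j then (d j : ℂ) else 0) :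
    Mᴴ * M = Matrix.diagonal fun j => ((d j ^ 2 : ℝ) : ℂ) := by
  subst hM
  ext j j'
  simp only [Matrix.mul_apply, Matrix.conjTranspose_apply, Matrix.of_apply]
  by_cases hj : d j = 0
  · simp [hj, Matrix.diagonal_apply]
  obtain ⟨i, hi⟩ := hp j hj
  rw [Finset.sum_eq_single i]
  · rw [if_pos hi]
    by_cases h : j = j'
    · subst h
      rw [if_pos hi, Matrix.diagonal_apply_eq]
      simp [sq]
    · rw [if_neg fun h' => h (hp₂ _ _ _ hi h'), mul_zero, Matrix.diagonal_apply_ne _ h]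
  · intro i' _ hi'
    rw [if_neg fun h' => hi' (hp₁ _ _ _ h' hi)]
    simp
  · simp

lemma Fin.prod_blocks {R : Type*} [CommMonoid R] {n r s : ℕ} (h : r + s ≤ n) (x z : R)
    (y : Fin s → R) :
    ∏ j : Fin n, (if (j : ℕ) < r then x else if h : (j : ℕ) - r < s then y ⟨_, h⟩ else z) =
      x ^ r * (∏ i, y i) * z ^ (n - r - s) := by
  obtain ⟨u, rfl⟩ := Nat.exists_eq_add_of_le h
  rw [Fin.prod_univ_add, Fin.prod_univ_add]
  have hu : r + s + u - r - s = u := by omega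
  rw [hu]
  congr 1
  · simp
  · have : ∀ i : Fin u, ¬ (r + s + (i : ℕ) < r) ∧ ¬ (r + s + (i : ℕ) - r < s) := fun i => by omega
    simp [this]

/-- A congruence multiplies numerator and denominator by the same factor, so the quotient may be
computed after simultaneous diagonalisation. -/
lemma pencilDet_of_congruence {n : ℕ} {S T Q : Matrix (Fin n) (Fin n) ℂ} {d : Fin n → ℂ}
    (hS : Qᴴ * S * Q = 1) (hT : Qᴴ * T * Q = Matrix.diagonal d) (t : ℂ) :
    pencilDet S T t = ∏ i, (t + d i) := by
  have h1 : Qᴴ.det * S.det * Q.det = 1 := by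
    rw [← Matrix.det_mul, ← Matrix.det_mul, hS, Matrix.det_one]
  have h2 : Qᴴ.det * (t • S + T).det * Q.det = ∏ i, (t + d i) := by
    rw [← Matrix.det_mul, ← Matrix.det_mul, Matrix.mul_add, Matrix.add_mul, Matrix.mul_smul,
      Matrix.smul_mul, hS, hT, ← Matrix.diagonal_one, ← Matrix.diagonal_smul,
      Matrix.diagonal_add, Matrix.det_diagonal]
    simp
  have hS0 : S.det ≠ 0 := by
    intro h
    rw [h] at h1
    simp at h1
  rw [pencilDet, div_eq_iff hS0, ← h2]
  linear_combination -(t • S + T).det * h1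

namespace GSVD

variable {m n q r s : ℕ} {A : Matrix (Fin m) (Fin n) ℂ} {C : Matrix (Fin q) (Fin n) ℂ}

lemma w_nonneg {k : ℕ} (G : GSVD A C k r s) (i : Fin s) : 0 ≤ G.w i := by
  unfold w; positivity

open scoped ComplexOrder in
-- For `k = n` no padding occurs, and `Q` is a congruence taking `AᴴA + CᴴC` to `1` and `CᴴC` to the
-- diagonal with blocks `0`, `β ^ 2`, `1`. The formula holds for every GSVD, so the law of `w`
-- cannot depend on the choice.
lemma pencilDet_eq (G : GSVD A C n r s) (k : ℕ) :
    pencilDet (Aᴴ * A + Cᴴ * C) (Cᴴ * C) ((k : ℂ) + 1) =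
      ((k : ℂ) + 1) ^ r * tuplePoly G.w k * ((k : ℂ) + 2) ^ (n - r - s) := by
  classical
  have hk := G.rank_k
  have hr := G.rank_r
  have hs := G.rank_s
  rw [hk] at hr hs
  have hAm : A.rank ≤ m := Matrix.rank_le_height A
  have hCq : C.rank ≤ q := Matrix.rank_le_height C
  have hAn : A.rank ≤ n := Matrix.rank_le_width A
  let a : Fin n → ℝ := fun j =>
    if (j : ℕ) < r then 1 else if h : (j : ℕ) - r < s then G.α ⟨(j : ℕ) - r, h⟩ else 0
  let c : Fin n → ℝ := fun j =>
    if (j : ℕ) < r then 0 else if h : (j : ℕ) - r < s then G.β ⟨(j : ℕ) - r, h⟩ else 1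
  have hA : (sigmaA m n r G.α)ᴴ * sigmaA m n r G.α =
      Matrix.diagonal fun j => ((a j ^ 2 : ℝ) : ℂ) := by
    refine gram_of_rel (fun i j => (i : ℕ) = j) a (fun j hj => ?_)
      (fun i i' j h h' => Fin.ext (by omega)) (fun i j j' h h' => Fin.ext (by omega)) ?_
    · have : (j : ℕ) < m := by
        by_contra h
        apply hj
        simp only [a]
        rw [if_neg (by omega), dif_neg (by omega)]
      exact ⟨⟨j, this⟩, rfl⟩
    · ext i j
      simp only [sigmaA, Matrix.of_apply, a]
      split_ifs <;> simp
  have hC : (sigmaC q n r G.β)ᴴ * sigmaC q n r G.β =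
      Matrix.diagonal fun j => ((c j ^ 2 : ℝ) : ℂ) := by
    refine gram_of_rel (fun i j => (i : ℕ) + n = q + j) c (fun j hj => ?_)
      (fun i i' j h h' => Fin.ext (by omega)) (fun i j j' h h' => Fin.ext (by omega)) ?_
    · have h1 : ¬ (j : ℕ) < r := fun h => hj (by simp only [c]; rw [if_pos h])
      have := j.2
      exact ⟨⟨q + j - n, by omega⟩, show q + (j : ℕ) - n + n = q + j by omega⟩
    · ext i j
      simp only [sigmaC, Matrix.of_apply, c]
      split_ifs <;> simp
  have hac : ∀ j, a j ^ 2 + c j ^ 2 = 1 := by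
    intro j
    simp only [a, c]
    split_ifs with h1 h2
    · norm_num
    · exact G.sq_add_sq _
    · norm_num
  have hgram : ∀ {l : ℕ} {M : Matrix (Fin l) (Fin n) ℂ} {X : Matrix (Fin l) (Fin l) ℂ}
      {D : Matrix (Fin l) (Fin n) ℂ}, X ∈ Matrix.unitaryGroup (Fin l) ℂ →
      X * M * G.Q = padZero l n D → G.Qᴴ * (Mᴴ * M) * G.Q = Dᴴ * D := by
    intro l M X D hX h
    rw [padZero_self] at h
    rw [← h, Matrix.conjTranspose_mul, Matrix.conjTranspose_mul]
    have h1 : Xᴴ * (X * (M * G.Q)) = M * G.Q := by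
      rw [← Matrix.mul_assoc, ← Matrix.star_eq_conjTranspose X, Matrix.mem_unitaryGroup_iff'.1 hX,
        Matrix.one_mul]
    simp only [Matrix.mul_assoc, h1]
  have hQA := (hgram G.U_unitary G.factor_A).trans hA
  have hQC := (hgram G.V_unitary G.factor_C).trans hC
  have hQS : G.Qᴴ * (Aᴴ * A + Cᴴ * C) * G.Q = 1 := by
    rw [Matrix.mul_add, Matrix.add_mul, hQA, hQC, Matrix.diagonal_add, ← Matrix.diagonal_one]
    congr 1
    ext j
    exact_mod_cast hac j
  have hQu : IsUnit G.Q.det := by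
    have := congrArg Matrix.det hQS
    rw [Matrix.det_mul, Matrix.det_one] at this
    exact IsUnit.of_mul_eq_one_right _ this
  have hQu' : IsUnit (G.Qᴴ).det := by rw [Matrix.det_conjTranspose]; exact hQu.star
  have hcard : (Finset.univ.filter fun j => c j ≠ 0).card = C.rank := by
    have h := congrArg Matrix.rank hQC
    rw [Matrix.rank_mul_eq_left_of_isUnit_det _ _ hQu,
      Matrix.rank_mul_eq_right_of_isUnit_det _ _ hQu', Matrix.rank_conjTranspose_mul_self,
      Matrix.rank_diagonal, Fintype.card_subtype] at h
    rw [h]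
    congr 1
    ext j
    simp
  -- Exactly `rank C = n - r` entries of `c` are nonzero and the first `r` vanish, so no other entry
  -- does. In particular each `β i` is nonzero, and the division defining `w i` is genuine.
  have hc0 : ∀ j : Fin n, ¬ (j : ℕ) < r → c j ≠ 0 := by
    have hsub : (Finset.univ.filter fun j => c j ≠ 0) ⊆
        Finset.univ.filter fun j : Fin n => ¬ (j : ℕ) < r := by
      intro j hj
      simp only [Finset.mem_filter, Finset.mem_univ, true_and] at hj ⊢
      exact fun h => hj (by simp only [c]; rw [if_pos h])
    have hcard' : (Finset.univ.filter fun j : Fin n => ¬ (j : ℕ) < r).card ≤ C.rank := by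
      have h := Finset.card_filter_add_card_filter_not (s := (Finset.univ : Finset (Fin n)))
        (fun j => (j : ℕ) < r)
      have h2 : (Finset.univ.filter fun j : Fin n => (j : ℕ) < r).card = r := by
        rw [Fin.card_filter_val_lt]
        omega
      simp only [Finset.card_univ, Fintype.card_fin] at h
      omega
    have heq := Finset.eq_of_subset_of_card_le hsub (by rw [hcard]; exact hcard')
    intro j hj
    have : j ∈ Finset.univ.filter fun j : Fin n => ¬ (j : ℕ) < r := by simpa using hj
    rw [← heq] at this
    simpa using this
  have hβ : ∀ i, G.β i ^ 2 = (1 + G.w i)⁻¹ := by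
    intro i
    have h := hc0 ⟨r + i, by omega⟩ (by simp)
    have hβ0 : G.β i ≠ 0 := by
      simp only [c] at h
      rw [if_neg (by omega), dif_pos (by omega)] at h
      convert h using 2
      exact Fin.ext (by simp)
    have h1 := G.sq_add_sq i
    rw [w]
    field_simp
    linarith
  rw [pencilDet_of_congruence hQS hQC]
  have h2 : ∀ j : Fin n, ((k : ℂ) + 1 + ((c j ^ 2 : ℝ) : ℂ)) =
      if (j : ℕ) < r then (k : ℂ) + 1 else if h : (j : ℕ) - r < s then
        (fun i => (k : ℂ) + 1 + ((1 + G.w i)⁻¹ : ℝ)) ⟨_, h⟩ else (k : ℂ) + 2 := by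
    intro j
    simp only [c, ← hβ]
    split_ifs
    · simp
    · simp
    · push_cast; ring
  have hrs : r + s ≤ n := by omega
  exact (Finset.prod_congr rfl fun j _ => h2 j).trans (Fin.prod_blocks hrs
    ((k : ℂ) + 1) ((k : ℂ) + 2) fun i => (k : ℂ) + 1 + ((1 + G.w i)⁻¹ : ℝ))

end GSVD

/-! ### Spectrum and pencil determinant of the quotient matrix -/

section Eigenvalues

variable {m p n s : ℕ} {X : Matrix (Fin m) (Fin p) ℂ} {Y : Matrix (Fin m) (Fin n) ℂ}

open scoped ComplexOrder in
lemma posSemidef_quotient (X : Matrix (Fin m) (Fin p) ℂ) (Y : Matrix (Fin m) (Fin n) ℂ) :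
    (Xᴴ * (Y * Yᴴ)⁻¹ * X).PosSemidef :=
  (Matrix.posSemidef_self_mul_conjTranspose Y).inv.conjTranspose_mul_mul_same X

open scoped ComplexOrder in
lemma Matrix.PosSemidef.exists_unitary_antitone {H : Matrix (Fin n) (Fin n) ℂ}
    (hH : H.PosSemidef) :
    ∃ W ∈ Matrix.unitaryGroup (Fin n) ℂ, ∃ a : Fin n → ℝ, Antitone a ∧ (∀ i, 0 ≤ a i) ∧
      Wᴴ * H * W = Matrix.diagonal fun i => (a i : ℂ) := by
  obtain ⟨W, hW, a, ha, h⟩ := hH.isHermitian.exists_unitary_antitone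
  refine ⟨W, hW, a, ha, fun i => ?_, h⟩
  have h1 := (hH.conjTranspose_mul_mul_same W).diag_nonneg (i := i)
  rw [h, Matrix.diagonal_apply_eq] at h1
  exact_mod_cast h1

open scoped ComplexOrder in
lemma Matrix.PosSemidef.exists_isNonzeroEigenvalueTuple {H : Matrix (Fin n) (Fin n) ℂ}
    (hH : H.PosSemidef) (hs : H.rank = s) : ∃ v : Fin s → ℝ, IsNonzeroEigenvalueTuple H v := by
  classical
  obtain ⟨W, hW, a, ha, ha0, h⟩ := hH.exists_unitary_antitone
  have hsn : s ≤ n := by rw [← hs]; exact Matrix.rank_le_width H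
  refine ⟨_, isNonzeroEigenvalueTuple_of_unitary_diagonalization hsn hW h ?_⟩
  refine Fin.iff_lt_of_card (fun i j hij hj => ?_) ?_
  · exact ((lt_of_le_of_ne (ha0 j) (Ne.symm hj)).trans_le (ha hij)).ne'
  · rw [← hs, Matrix.rank_eq_of_unitary_diagonalization hW h]
    simp

open scoped ComplexOrder MatrixOrder in
-- With `(YYᴴ)⁻¹ = RᴴR` and `R` invertible, the quotient is the Gram matrix of `RX`.
lemma rank_quotient (hY : IsUnit (Y * Yᴴ).det) : (Xᴴ * (Y * Yᴴ)⁻¹ * X).rank = X.rank := by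
  obtain ⟨R, hR⟩ := CStarAlgebra.nonneg_iff_eq_star_mul_self.1
    (Matrix.posSemidef_self_mul_conjTranspose Y).inv.nonneg
  have hRu : IsUnit R.det := by
    have h1 := congrArg Matrix.det hR
    rw [Matrix.det_mul] at h1
    have h2 : IsUnit ((Y * Yᴴ)⁻¹).det := Matrix.isUnit_nonsing_inv_det _ hY
    rw [h1] at h2
    exact isUnit_of_mul_isUnit_right h2
  have h : Xᴴ * (Y * Yᴴ)⁻¹ * X = (R * X)ᴴ * (R * X) := by
    rw [hR, Matrix.star_eq_conjTranspose, Matrix.conjTranspose_mul]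
    simp only [Matrix.mul_assoc]
  rw [h, Matrix.rank_conjTranspose_mul_self, Matrix.rank_mul_eq_right_of_isUnit_det _ _ hRu]

open scoped ComplexOrder in
lemma Matrix.PosSemidef.tuple_nonneg {H : Matrix (Fin n) (Fin n) ℂ} (hH : H.PosSemidef)
    {v : Fin s → ℝ} (hv : IsNonzeroEigenvalueTuple H v) (i : Fin s) : 0 ≤ v i := by
  obtain ⟨W, hW, a, -, ha0, h⟩ := hH.exists_unitary_antitone
  rw [IsNonzeroEigenvalueTuple, nonzeroEigenvalues_of_unitary_diagonalization hW h] at hv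
  have : (v i : ℂ) ∈ Finset.univ.val.map fun i => (v i : ℂ) :=
    Multiset.mem_map_of_mem _ (Finset.mem_univ i)
  rw [← hv] at this
  obtain ⟨j, -, hj⟩ := Multiset.mem_map.1 this
  have : a j = v i := by exact_mod_cast hj
  exact this ▸ ha0 j

open scoped ComplexOrder in
lemma Matrix.PosSemidef.det_one_add_smul {H : Matrix (Fin n) (Fin n) ℂ} (hH : H.PosSemidef)
    {v : Fin s → ℝ} (hv : IsNonzeroEigenvalueTuple H v) (u : ℂ) :
    (1 + u • H).det = ∏ i, (1 + u * v i) := by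
  classical
  obtain ⟨W, hW, a, -, ha0, h⟩ := hH.exists_unitary_antitone
  rw [IsNonzeroEigenvalueTuple, nonzeroEigenvalues_of_unitary_diagonalization hW h] at hv
  have hWW : Wᴴ * W = 1 := Matrix.mem_unitaryGroup_iff'.1 hW
  have h1 : Wᴴ * (1 + u • H) * W = Matrix.diagonal fun i => 1 + u * (a i : ℂ) := by
    rw [Matrix.mul_add, Matrix.add_mul, Matrix.mul_one, hWW, Matrix.mul_smul, Matrix.smul_mul, h,
      ← Matrix.diagonal_one, ← Matrix.diagonal_smul, Matrix.diagonal_add]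
    rfl
  have h2 : (Wᴴ).det * W.det = 1 := by rw [← Matrix.det_mul, hWW, Matrix.det_one]
  have h3 : (1 + u • H).det = ∏ i, (1 + u * (a i : ℂ)) := by
    rw [← Matrix.det_diagonal, ← h1, Matrix.det_mul, Matrix.det_mul]
    linear_combination -(1 + u • H).det * h2
  have h4 := congrArg (fun S : Multiset ℂ => (S.map fun z => 1 + u * z).prod) hv
  simp only [Multiset.map_map, Function.comp_def] at h4
  rw [h3]
  change _ = (Finset.univ.val.map fun i => 1 + u * (v i : ℂ)).prod
  rw [← h4]
  change _ = ∏ i ∈ Finset.univ.filter fun i => (a i : ℂ) ≠ 0, (1 + u * (a i : ℂ))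
  refine (Finset.prod_subset (Finset.subset_univ _) fun i _ hi => ?_).symm
  have : (a i : ℂ) = 0 := by simpa using hi
  rw [this]; simp

/-- Everything reduces to `det (YYᴴ + u XXᴴ) = det (YYᴴ) ∏ (1 + u v i)`, used at `u = 1` for the
denominator and at `u = t / (t + 1)`, with `t = k + 1`, for the numerator. -/
lemma pencilDet_quotient (hY : IsUnit (Y * Yᴴ).det) {v : Fin s → ℝ}
    (hv : IsNonzeroEigenvalueTuple (Xᴴ * (Y * Yᴴ)⁻¹ * X) v) (hs : s ≤ m) (k : ℕ) :
    pencilDet (X * Xᴴ + Y * Yᴴ) (Y * Yᴴ) ((k : ℂ) + 1) =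
      tuplePoly v k * ((k : ℂ) + 2) ^ (m - s) := by
  have hpos := posSemidef_quotient X Y
  have hv0 := hpos.tuple_nonneg hv
  have hk2 : (k : ℂ) + 2 ≠ 0 := by exact_mod_cast (by omega : k + 2 ≠ 0)
  have hdet : ∀ u : ℂ, (Y * Yᴴ + u • (X * Xᴴ)).det = (Y * Yᴴ).det * ∏ i, (1 + u * v i) := by
    intro u
    rw [← hpos.det_one_add_smul hv]
    have : Y * Yᴴ + u • (X * Xᴴ) = Y * Yᴴ * (1 + (Y * Yᴴ)⁻¹ * (u • (X * Xᴴ))) := by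
      rw [Matrix.mul_add, Matrix.mul_one, Matrix.mul_nonsing_inv_cancel_left _ _ hY]
    rw [this, Matrix.det_mul]
    congr 1
    rw [show (Y * Yᴴ)⁻¹ * (u • (X * Xᴴ)) = ((Y * Yᴴ)⁻¹ * X) * (u • Xᴴ) by
      simp only [Matrix.mul_smul, Matrix.mul_assoc], Matrix.det_one_add_mul_comm]
    simp only [Matrix.smul_mul, Matrix.mul_assoc]
  have hS : (X * Xᴴ + Y * Yᴴ).det = (Y * Yᴴ).det * ∏ i, (1 + (v i : ℂ)) := by
    have := hdet 1
    simp only [one_smul, one_mul] at this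
    rw [add_comm, this]
  have hT : (((k : ℂ) + 1) • (X * Xᴴ + Y * Yᴴ) + Y * Yᴴ).det =
      ((k : ℂ) + 2) ^ m * ((Y * Yᴴ).det * ∏ i, (1 + ((k : ℂ) + 1) / (k + 2) * v i)) := by
    rw [← hdet]
    have : ((k : ℂ) + 1) • (X * Xᴴ + Y * Yᴴ) + Y * Yᴴ =
        ((k : ℂ) + 2) • (Y * Yᴴ + (((k : ℂ) + 1) / (k + 2)) • (X * Xᴴ)) := by
      rw [smul_add, smul_add, smul_smul, mul_div_cancel₀ _ hk2]
      module
    rw [this, Matrix.det_smul, Fintype.card_fin]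
  have h1v : ∀ i, (1 + (v i : ℂ)) ≠ 0 := fun i => by
    have := hv0 i
    exact_mod_cast (by positivity : 1 + v i ≠ 0)
  have hprod : (∏ i, (1 + (v i : ℂ))) ≠ 0 := Finset.prod_ne_zero_iff.2 fun i _ => h1v i
  rw [pencilDet, hS, hT, div_eq_iff (mul_ne_zero hY.ne_zero hprod)]
  have hfac : tuplePoly v k * ∏ i, (1 + (v i : ℂ)) =
      ((k : ℂ) + 2) ^ s * ∏ i, (1 + ((k : ℂ) + 1) / (k + 2) * v i) := by
    have : ((k : ℂ) + 2) ^ s = ∏ _i : Fin s, ((k : ℂ) + 2) := by simp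
    rw [this, tuplePoly, ← Finset.prod_mul_distrib, ← Finset.prod_mul_distrib]
    refine Finset.prod_congr rfl fun i _ => ?_
    have := h1v i
    push_cast
    field_simp
    ring
  have hpow : ((k : ℂ) + 2) ^ m = ((k : ℂ) + 2) ^ (m - s) * ((k : ℂ) + 2) ^ s := by
    rw [← pow_add, Nat.sub_add_cancel hs]
  rw [hpow]
  linear_combination -(((k : ℂ) + 2) ^ (m - s) * (Y * Yᴴ).det) * hfac

end Eigenvalues

/-! ### Recovering a sorted tuple measurably -/

section TuplePoly

variable {s : ℕ}

lemma measurable_tuplePoly : Measurable (tuplePoly : (Fin s → ℝ) → ℕ → ℂ) := by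
  refine measurable_pi_lambda _ fun k => ?_
  unfold tuplePoly
  fun_prop

lemma tuplePoly_sortTuple (v : Fin s → ℝ) : tuplePoly (sortTuple v) = tuplePoly v := by
  ext k
  exact Equiv.prod_comp (Tuple.sort v) fun i => ((k : ℂ) + 1 + ((1 + v i)⁻¹ : ℝ))

lemma Monotone.eq_of_map_univ_eq {v w : Fin s → ℝ} (hv : Monotone v) (hw : Monotone w)
    (h : Finset.univ.val.map v = Finset.univ.val.map w) : v = w := by
  rw [Fin.univ_val_map, Fin.univ_val_map, Multiset.coe_eq_coe] at h
  exact List.ofFn_injective (h.eq_of_sortedLE hv.sortedLE_ofFn hw.sortedLE_ofFn)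

open Polynomial in
lemma tuplePoly_injOn :
    Set.InjOn (tuplePoly : (Fin s → ℝ) → ℕ → ℂ) {v | Monotone v ∧ ∀ i, 0 ≤ v i} := by
  rintro v ⟨hv, -⟩ w ⟨hw, -⟩ h
  refine hv.eq_of_map_univ_eq hw ?_
  -- The root `-1 / (1 + x)` is shifted by `-1` because the evaluation point is `k` rather than `k +
  -- 1`; `g` undoes `f`, also at `x = -1`, where `0⁻¹ = 0`.
  let f : ℝ → ℂ := fun x => -1 - ((1 + x)⁻¹ : ℝ)
  let g : ℂ → ℝ := fun z => (-1 - z.re)⁻¹ - 1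
  have hgf : ∀ x, g (f x) = x := fun x => by
    have : (f x).re = -1 - (1 + x)⁻¹ := by
      simp only [f, Complex.sub_re, Complex.ofReal_re, Complex.neg_re, Complex.one_re]
    simp [g, this]
  have heval : ∀ (u : Fin s → ℝ) (k : ℕ), (∏ i, (X - C (f (u i)))).eval (k : ℂ) = tuplePoly u k := by
    intro u k
    rw [eval_prod, tuplePoly]
    refine Finset.prod_congr rfl fun i _ => ?_
    simp only [eval_sub, eval_X, eval_C, f]
    ring
  have hpoly : (∏ i, (X - C (f (v i)))) = ∏ i, (X - C (f (w i))) := by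
    apply Polynomial.eq_of_infinite_eval_eq
    refine (Set.infinite_range_of_injective (Nat.cast_injective (R := ℂ))).mono ?_
    rintro _ ⟨k, rfl⟩
    change eval _ _ = eval _ _
    rw [heval, heval, h]
  have hroots : ∀ u : Fin s → ℝ, ((∏ i, (X - C (f (u i)))).roots.map g) = Finset.univ.val.map u := by
    intro u
    rw [Polynomial.roots_prod _ _ (Finset.prod_ne_zero_iff.2 fun i _ => X_sub_C_ne_zero _)]
    simp only [roots_X_sub_C, Multiset.bind_singleton, Multiset.map_map, Function.comp_def, hgf]
  rw [← hroots v, ← hroots w, hpoly]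

/-- Lusin–Souslin: an injective measurable map on a standard Borel space is a measurable embedding,
so its inverse extends measurably. -/
lemma exists_measurable_leftInverse_tuplePoly (s : ℕ) :
    ∃ g : (ℕ → ℂ) → Fin s → ℝ, Measurable g ∧
      ∀ v, Monotone v → (∀ i, 0 ≤ v i) → g (tuplePoly v) = v := by
  let D : Set (Fin s → ℝ) := {v | Monotone v ∧ ∀ i, 0 ≤ v i}
  have hD : MeasurableSet D := by
    apply IsClosed.measurableSet
    have : D = (⋂ i, ⋂ j, ⋂ (_ : i ≤ j), {v | v i ≤ v j}) ∩ ⋂ i, {v | 0 ≤ v i} := by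
      ext v
      simp only [D, Monotone, Set.mem_inter_iff, Set.mem_iInter, Set.mem_ofPred_eq]
    rw [this]
    refine IsClosed.inter (isClosed_iInter fun i => isClosed_iInter fun j => isClosed_iInter
      fun _ => isClosed_le (by fun_prop) (by fun_prop)) (isClosed_iInter fun i =>
        isClosed_le (by fun_prop) (by fun_prop))
  have := hD.standardBorel
  have he : MeasurableEmbedding fun v : D => tuplePoly (v : Fin s → ℝ) :=
    (measurable_tuplePoly.comp measurable_subtype_coe).measurableEmbedding
      (Set.injOn_iff_injective.1 tuplePoly_injOn)
  obtain ⟨g, hg, hgv⟩ := he.exists_measurable_extend measurable_subtype_coe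
    fun _ => (inferInstance : Nonempty (Fin s → ℝ))
  exact ⟨g, hg, fun v h1 h2 => congrFun hgv ⟨v, h1, h2⟩⟩

lemma monotone_sortTuple (v : Fin s → ℝ) : Monotone (sortTuple v) := Tuple.monotone_sort v

/-- Random tuples are identically distributed up to order as soon as rescaled values of their
polynomials are. -/
lemma identDistrib_sortTuple {Ω Ω' : Type*} [MeasurableSpace Ω] [MeasurableSpace Ω']
    {P : Measure Ω} {P' : Measure Ω'} {F : Ω → ℕ → ℂ} {F' : Ω' → ℕ → ℂ}
    (hF : IdentDistrib F F' P P') {d : ℕ → ℂ} (hd : ∀ k, d k ≠ 0)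
    {w : Ω → Fin s → ℝ} {v : Ω' → Fin s → ℝ}
    (hw : ∀ᵐ ω ∂P, (∀ i, 0 ≤ w ω i) ∧ ∀ k, F ω k = d k * tuplePoly (w ω) k)
    (hv : ∀ᵐ ω ∂P', (∀ i, 0 ≤ v ω i) ∧ ∀ k, F' ω k = d k * tuplePoly (v ω) k) :
    IdentDistrib (fun ω => sortTuple (w ω)) (fun ω => sortTuple (v ω)) P P' := by
  obtain ⟨g, hg, hgv⟩ := exists_measurable_leftInverse_tuplePoly s
  let h : (ℕ → ℂ) → Fin s → ℝ := fun x => g fun k => x k / d k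
  have hh : Measurable h := hg.comp (by fun_prop)
  have hkey : ∀ (x : ℕ → ℂ) (u : Fin s → ℝ), (∀ i, 0 ≤ u i) →
      (∀ k, x k = d k * tuplePoly u k) → h x = sortTuple u := by
    intro x u hu hx
    rw [← hgv (sortTuple u) (monotone_sortTuple u) fun i => hu _]
    simp only [h]
    congr 1
    ext k
    rw [hx, mul_div_cancel_left₀ _ (hd k), tuplePoly_sortTuple]
  have hid := hF.comp hh
  have h1 : h ∘ F =ᵐ[P] fun ω => sortTuple (w ω) := by
    filter_upwards [hw] with ω hω using hkey _ _ hω.1 hω.2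
  have h2 : h ∘ F' =ᵐ[P'] fun ω => sortTuple (v ω) := by
    filter_upwards [hv] with ω hω using hkey _ _ hω.1 hω.2
  exact ((IdentDistrib.of_ae_eq hid.aemeasurable_fst h1).symm.trans hid).trans
    (IdentDistrib.of_ae_eq hid.aemeasurable_snd h2)

end TuplePoly

/-! ### Laws of Gaussian matrices -/

section Laws

variable {Ω : Type*} [MeasurableSpace Ω] {P : Measure Ω}
  {ι κ ι' κ' : Type*} [Fintype ι] [Fintype κ] [Fintype ι'] [Fintype κ']

lemma IsStdGaussianMatrix.hasLaw_entries {A : Ω → Matrix ι κ ℂ} (hA : IsStdGaussianMatrix A P) :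
    HasLaw (fun ω (p : ι × κ) => A ω p.1 p.2) (gaussianPi (ι × κ)) P :=
  hA.iIndep.hasLaw_pi fun p => hA.hasLaw p.1 p.2

lemma ProbabilityTheory.HasLaw.ae_rank_eq {A : Ω → Matrix ι κ ℂ}
    (hA : HasLaw (fun ω (p : ι × κ) => A ω p.1 p.2) (gaussianPi (ι × κ)) P) :
    ∀ᵐ ω ∂P, (A ω).rank = min (Fintype.card ι) (Fintype.card κ) :=
  ae_of_ae_map hA.aemeasurable (by rw [hA.map_eq]; exact _root_.ae_rank_eq)

lemma IsIndepStdGaussianPair.hasLaw_sumElim [IsFiniteMeasure P] {A : Ω → Matrix ι κ ℂ}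
    {C : Ω → Matrix ι' κ' ℂ} (h : IsIndepStdGaussianPair A C P) :
    HasLaw (fun ω => Sum.elim (fun p : ι × κ => A ω p.1 p.2) (fun p : ι' × κ' => C ω p.1 p.2))
      (gaussianPi (ι × κ ⊕ ι' × κ')) P :=
  measurePreserving_gaussianPi_sumElim.fun_comp_hasLaw
    (h.indep.hasLaw_prod h.left.hasLaw_entries h.right.hasLaw_entries)

lemma IsIndepStdGaussianPair.hasLaw_fromRows [IsFiniteMeasure P] {A : Ω → Matrix ι κ ℂ}
    {C : Ω → Matrix ι' κ ℂ} (h : IsIndepStdGaussianPair A C P) :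
    HasLaw (fun ω (p : (ι ⊕ ι') × κ) => Matrix.fromRows (A ω) (C ω) p.1 p.2)
      (gaussianPi ((ι ⊕ ι') × κ)) P := by
  convert (measurePreserving_gaussianPi_reindex (Equiv.sumProdDistrib ι ι' κ)).fun_comp_hasLaw
    h.hasLaw_sumElim using 3 with ω p
  rcases p with ⟨i | i, j⟩ <;> rfl

/-- Transposition only relabels the entries, and each entry law is invariant under conjugation. -/
lemma IsIndepStdGaussianPair.hasLaw_fromRows_conjTranspose [IsFiniteMeasure P]
    {X : Ω → Matrix ι κ ℂ} {Y : Ω → Matrix ι κ' ℂ} (h : IsIndepStdGaussianPair X Y P) :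
    HasLaw (fun ω (p : (κ ⊕ κ') × ι) => Matrix.fromRows (X ω)ᴴ (Y ω)ᴴ p.1 p.2)
      (gaussianPi ((κ ⊕ κ') × ι)) P := by
  convert measurePreserving_gaussianPi_star.fun_comp_hasLaw
    ((measurePreserving_gaussianPi_reindex ((Equiv.sumProdDistrib κ κ' ι).trans
      ((Equiv.prodComm κ ι).sumCongr (Equiv.prodComm κ' ι)))).fun_comp_hasLaw
      h.hasLaw_sumElim) using 3 with ω p
  rcases p with ⟨i | i, j⟩ <;> rfl

open scoped ComplexOrder in
lemma ae_quotient_spectrum {m p n s : ℕ} [IsFiniteMeasure P] {X : Ω → Matrix (Fin m) (Fin p) ℂ}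
    {Y : Ω → Matrix (Fin m) (Fin n) ℂ} (h : IsIndepStdGaussianPair X Y P) (hmn : m ≤ n)
    (hs : min m p = s) :
    ∀ᵐ ω ∂P, IsUnit (Y ω * (Y ω)ᴴ) ∧
      ∃ v : Fin s → ℝ, IsNonzeroEigenvalueTuple ((X ω)ᴴ * (Y ω * (Y ω)ᴴ)⁻¹ * X ω) v := by
  filter_upwards [h.left.hasLaw_entries.ae_rank_eq, h.right.hasLaw_entries.ae_rank_eq]
    with ω hX hY
  simp only [Fintype.card_fin] at hX hY
  have hdet : IsUnit (Y ω * (Y ω)ᴴ).det := Matrix.isUnit_det_of_rank_eq_card (by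
    rw [Matrix.rank_self_mul_conjTranspose, hY, min_eq_left hmn, Fintype.card_fin])
  exact ⟨(Matrix.isUnit_iff_isUnit_det _).2 hdet,
    (posSemidef_quotient (X ω) (Y ω)).exists_isNonzeroEigenvalueTuple
      (by rw [rank_quotient hdet, hX, hs])⟩

end Laws

/-! ### Comparison of the two laws -/

section GramPencil

/-- Relabelling the rows changes neither Gram matrix. It lets stacked matrices with row types `Fin s
⊕ Fin n` and `Fin m ⊕ Fin q` share one index type. -/
lemma gramPencil_submatrix_equiv {N N' n q : Type*} [Fintype N] [Fintype N'] [Fintype n]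
    [DecidableEq n] [Fintype q] (e : N' ≃ N) (K : q → N') (c : ℕ) (D : Matrix N' n ℂ) :
    gramPencil (e ∘ K) c (D.submatrix e.symm id) = gramPencil K c D := by
  ext k
  have h1 : (D.submatrix e.symm id).submatrix (e ∘ K) id = D.submatrix K id := by
    ext i j; simp
  rw [gramPencil, gramPencil, h1, Matrix.conjTranspose_submatrix, Matrix.submatrix_mul_equiv,
    Matrix.submatrix_id_id]

lemma gramPencil_fromRows {m n q : ℕ} (A : Matrix (Fin m) (Fin n) ℂ) (C : Matrix (Fin q) (Fin n) ℂ)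
    (c k : ℕ) :
    gramPencil Sum.inr c (Matrix.fromRows A C) k =
      ((k : ℂ) + 1) ^ c * pencilDet (Aᴴ * A + Cᴴ * C) (Cᴴ * C) ((k : ℂ) + 1) := by
  have h : (Matrix.fromRows A C).submatrix Sum.inr id = C := by ext i j; rfl
  rw [gramPencil, h, gram_fromRows]

lemma GSVD.gramPencil_eq {m n q r s : ℕ} {A : Matrix (Fin m) (Fin n) ℂ}
    {C : Matrix (Fin q) (Fin n) ℂ} (G : GSVD A C n r s) (c k : ℕ) :
    gramPencil Sum.inr c (Matrix.fromRows A C) k =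
      (((k : ℂ) + 1) ^ (c + r) * ((k : ℂ) + 2) ^ (n - r - s)) * tuplePoly G.w k := by
  rw [gramPencil_fromRows, G.pencilDet_eq]
  ring

lemma gramPencil_quotient {m p n s : ℕ} {X : Matrix (Fin m) (Fin p) ℂ}
    {Y : Matrix (Fin m) (Fin n) ℂ} (hY : IsUnit (Y * Yᴴ)) {v : Fin s → ℝ}
    (hv : IsNonzeroEigenvalueTuple (Xᴴ * (Y * Yᴴ)⁻¹ * X) v) (hs : s ≤ m) (c k : ℕ) :
    gramPencil Sum.inr c (Matrix.fromRows Xᴴ Yᴴ) k =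
      (((k : ℂ) + 1) ^ c * ((k : ℂ) + 2) ^ (m - s)) * tuplePoly v k := by
  rw [gramPencil_fromRows, Matrix.conjTranspose_conjTranspose, Matrix.conjTranspose_conjTranspose,
    pencilDet_quotient ((Matrix.isUnit_iff_isUnit_det _).1 hY) hv hs]
  ring

/-- The generalized singular values and the eigenvalues of a quotient have the same law once the
pencil determinants of the underlying Gaussian matrices do. -/
lemma identDistrib_generalizedSingularValues {Ω Ω' : Type*} [MeasurableSpace Ω]
    [MeasurableSpace Ω'] {P : Measure Ω} {P' : Measure Ω'} {m n q r s m' p n' c c' : ℕ}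
    {A : Ω → Matrix (Fin m) (Fin n) ℂ} {C : Ω → Matrix (Fin q) (Fin n) ℂ}
    {X : Ω' → Matrix (Fin m') (Fin p) ℂ} {Y : Ω' → Matrix (Fin m') (Fin n') ℂ}
    (hid : IdentDistrib (fun ω => gramPencil Sum.inr c (Matrix.fromRows (A ω) (C ω)))
      (fun ω => gramPencil Sum.inr c' (Matrix.fromRows (X ω)ᴴ (Y ω)ᴴ)) P P')
    (hc : c' = c + r) (hs : s ≤ m') (hns : m' - s = n - r - s)
    (hY : ∀ᵐ ω ∂P', IsUnit (Y ω * (Y ω)ᴴ)) {w : Ω → Fin s → ℝ} {v : Ω' → Fin s → ℝ}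
    (hw : ∀ᵐ ω ∂P, ∃ G : GSVD (A ω) (C ω) n r s, w ω = G.w)
    (hv : ∀ᵐ ω ∂P', IsNonzeroEigenvalueTuple ((X ω)ᴴ * (Y ω * (Y ω)ᴴ)⁻¹ * X ω) (v ω)) :
    IdentDistrib (fun ω => sortTuple (w ω)) (fun ω => sortTuple (v ω)) P P' := by
  have h1 : ∀ k : ℕ, (k : ℂ) + 1 ≠ 0 := fun k => Nat.cast_add_one_ne_zero k
  have h2 : ∀ k : ℕ, (k : ℂ) + 2 ≠ 0 := fun k => by exact_mod_cast (by omega : k + 2 ≠ 0)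
  refine identDistrib_sortTuple hid
    (d := fun k => ((k : ℂ) + 1) ^ (c + r) * ((k : ℂ) + 2) ^ (n - r - s))
    (fun k => mul_ne_zero (pow_ne_zero _ (h1 k)) (pow_ne_zero _ (h2 k))) ?_ ?_
  · filter_upwards [hw] with ω ⟨G, hG⟩
    rw [hG]
    exact ⟨G.w_nonneg, G.gramPencil_eq c⟩
  · filter_upwards [hv, hY] with ω hvω hYω
    refine ⟨(posSemidef_quotient (X ω) (Y ω)).tuple_nonneg hvω, fun k => ?_⟩
    rw [gramPencil_quotient hYω hvω hs, hc, hns]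

end GramPencil

section Ident

variable {Ω Ω' : Type*} [MeasurableSpace Ω] [MeasurableSpace Ω'] {P : Measure Ω} {P' : Measure Ω'}

lemma hasLaw_gramPencil {N n q : Type*} [Fintype N] [Fintype n] [DecidableEq n] [Fintype q]
    {B : Ω → Matrix N n ℂ}
    (hB : HasLaw (fun ω (p : N × n) => B ω p.1 p.2) (gaussianPi (N × n)) P) (J : q → N) (c : ℕ) :
    HasLaw (fun ω => gramPencil J c (B ω))
      ((gaussianPi (N × n)).map fun x => gramPencil J c (toMat x)) P := by
  have hm := measurable_gramPencil (n := n) J c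
  have h : (fun ω => gramPencil J c (B ω)) =
      (fun x => gramPencil J c (toMat x)) ∘ fun ω (p : N × n) => B ω p.1 p.2 := by
    ext ω : 1
    rw [Function.comp_apply]
    congr 1
  rw [h]
  generalize (fun x : N × n → ℂ => gramPencil J c (toMat x)) = f at hm
  exact HasLaw.comp ⟨hm.aemeasurable, rfl⟩ hB

lemma ProbabilityTheory.HasLaw.identDistrib_of_law_eq {T : Type*} [MeasurableSpace T]
    {μ ν : Measure T} {F : Ω → T} {F' : Ω' → T} (h : HasLaw F μ P) (h' : HasLaw F' ν P')
    (hμ : μ = ν) : IdentDistrib F F' P P' :=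
  ⟨h.aemeasurable, h'.aemeasurable, by rw [h.map_eq, h'.map_eq, hμ]⟩

/-- The law of the pencil determinants attached to the pair `(A, C)` is that attached to the
quotient matrix of complementary dimensions. -/
lemma identDistrib_gramPencil {m n q s : ℕ} [IsFiniteMeasure P] [IsFiniteMeasure P']
    {A : Ω → Matrix (Fin m) (Fin n) ℂ} {C : Ω → Matrix (Fin q) (Fin n) ℂ}
    {X : Ω' → Matrix (Fin q) (Fin s) ℂ} {Y : Ω' → Matrix (Fin q) (Fin n) ℂ}
    (hAC : IsIndepStdGaussianPair A C P) (hXY : IsIndepStdGaussianPair X Y P')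
    (hs : s + n = m + q) :
    IdentDistrib (fun ω => gramPencil Sum.inr q (Matrix.fromRows (A ω) (C ω)))
      (fun ω => gramPencil Sum.inr n (Matrix.fromRows (X ω)ᴴ (Y ω)ᴴ)) P P' := by
  let e : Fin s ⊕ Fin n ≃ Fin m ⊕ Fin q := Fintype.equivOfCardEq (by simp [hs])
  have hD : HasLaw (fun ω (p : (Fin m ⊕ Fin q) × Fin q) =>
      ((Matrix.fromRows (X ω)ᴴ (Y ω)ᴴ).submatrix e.symm id) p.1 p.2)
      (gaussianPi ((Fin m ⊕ Fin q) × Fin q)) P' :=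
    (measurePreserving_gaussianPi_reindex
      (e.symm.prodCongr (Equiv.refl (Fin q)))).fun_comp_hasLaw hXY.hasLaw_fromRows_conjTranspose
  have h1 := hasLaw_gramPencil hAC.hasLaw_fromRows (Sum.inr : Fin q → Fin m ⊕ Fin q) q
  have h2 := hasLaw_gramPencil hD (e ∘ Sum.inr : Fin n → Fin m ⊕ Fin q) n
  simp only [gramPencil_submatrix_equiv] at h2
  refine h1.identDistrib_of_law_eq h2 ?_
  have := map_gramPencil_eq (N := Fin m ⊕ Fin q) (n := Fin n) (q := Fin q)
    (J := Sum.inr) Sum.inr_injective (K := e ∘ Sum.inr) (e.injective.comp Sum.inr_injective)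
  rwa [Fintype.card_fin, Fintype.card_fin] at this

end Ident

/-! ### The main theorem -/

theorem theorem1 {m n q k r s : ℕ} (hqm : m ≤ q)
    (hk : k = min (m + q) n)
    (hr : r = min (m + q) n - min q n)
    (hs : s = min m n + min q n - min (m + q) n)
    {Ω : Type*} [MeasurableSpace Ω] (P : Measure Ω) [IsProbabilityMeasure P]
    (A : Ω → Matrix (Fin m) (Fin n) ℂ) (C : Ω → Matrix (Fin q) (Fin n) ℂ)
    (hAC : IsIndepStdGaussianPair A C P) :
    -- almost surely a GSVD exists, and its dimensions are exactly the stated ones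
    (∀ᵐ ω ∂P, ∀ k' r' s' : ℕ,
      Nonempty (GSVD (A ω) (C ω) k' r' s') ↔ k' = k ∧ r' = r ∧ s' = s) ∧
    -- equality of the (joint, unordered) distributions
    (∀ m' p n' : ℕ,
      ((n ≤ q ∧ (m', p, n') = (n, m, q)) ∨ (q < n ∧ n < q + m ∧ (m', p, n') = (q, s, n))) →
      ∀ {Ω' : Type*} [MeasurableSpace Ω'] (P' : Measure Ω') [IsProbabilityMeasure P']
        (X : Ω' → Matrix (Fin m') (Fin p) ℂ) (Y : Ω' → Matrix (Fin m') (Fin n') ℂ),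
        IsIndepStdGaussianPair X Y P' →
        -- almost surely `Y Yᴴ` is invertible and `L` has exactly `s` nonzero eigenvalues, all real
        (∀ᵐ ω' ∂P', IsUnit (Y ω' * (Y ω')ᴴ) ∧
          ∃ v : Fin s → ℝ,
            IsNonzeroEigenvalueTuple ((X ω')ᴴ * (Y ω' * (Y ω')ᴴ)⁻¹ * X ω') v) ∧
        -- whatever GSVD and whatever order is chosen at each sample point
        (∀ (w : Ω → Fin s → ℝ) (v : Ω' → Fin s → ℝ),
          (∀ᵐ ω ∂P, ∃ G : GSVD (A ω) (C ω) k r s, w ω = G.w) →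
          (∀ᵐ ω' ∂P',
            IsNonzeroEigenvalueTuple ((X ω')ᴴ * (Y ω' * (Y ω')ᴴ)⁻¹ * X ω') (v ω')) →
          IdentDistrib (fun ω => sortTuple (w ω)) (fun ω' => sortTuple (v ω')) P P')) ∧
    -- the degenerate case
    (q + m ≤ n →
      s = 0 ∧
      ∃ (DA : Matrix (Fin m) (Fin k) ℂ) (DC : Matrix (Fin q) (Fin k) ℂ),
        ∀ᵐ ω ∂P, ∀ G : GSVD (A ω) (C ω) k r s, G.SigmaA = DA ∧ G.SigmaC = DC) := by

  have hA := hAC.left.hasLaw_entries.ae_rank_eq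
  have hC := hAC.right.hasLaw_entries.ae_rank_eq
  have hB := hAC.hasLaw_fromRows.ae_rank_eq
  simp only [Fintype.card_fin, Fintype.card_sum] at hA hC hB
  refine ⟨?_, ?_, ?_⟩
  · filter_upwards [hA, hC, hB] with ω hAω hCω hBω k' r' s'
    constructor
    · rintro ⟨G⟩
      have h1 := G.rank_k
      have h2 := G.rank_r
      have h3 := G.rank_s
      rw [hBω] at h1 h2 h3
      rw [hCω] at h2 h3
      rw [hAω] at h3
      omega
    · rintro ⟨rfl, rfl, rfl⟩
      exact nonempty_GSVD _ _ (by omega) (by omega) (by omega)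
  · rintro m' p n' (⟨hnq, h⟩ | ⟨hqn, hnqm, h⟩) Ω' _ P' _ X Y hXY
    · obtain ⟨h1, h2, h3⟩ : m' = n ∧ p = m ∧ n' = q := by simpa using h
      obtain rfl : k = n := by omega
      subst h1 h2 h3
      have hL := ae_quotient_spectrum hXY hnq (show min m' p = s by omega)
      refine ⟨hL, fun w v hw hv => ?_⟩
      -- Here `r = 0` and both stacked matrices have `m + q` rows and `n` columns up to relabelling
      -- of the variables, so the pencils already have the same law.
      refine identDistrib_generalizedSingularValues (c := 0) (c' := 0) ?_ (by omega) (by omega)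
        (by omega) (hL.mono fun ω h => h.1) hw hv
      exact (hasLaw_gramPencil hAC.hasLaw_fromRows _ _).identDistrib_of_law_eq
        (hasLaw_gramPencil hXY.hasLaw_fromRows_conjTranspose _ _) rfl
    · obtain ⟨h1, h2, h3⟩ : m' = q ∧ p = s ∧ n' = n := by simpa using h
      obtain rfl : k = n := by omega
      subst h1 h2 h3
      have hL := ae_quotient_spectrum hXY hqn.le (show min m' p = p by omega)
      refine ⟨hL, fun w v hw hv => ?_⟩
      -- Here `s = m + q - n` and `r = n - q`; the exponents `q` and `n` from the duality differ by
      -- exactly the factor `t ^ r` in the pencil of the GSVD.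
      exact identDistrib_generalizedSingularValues (identDistrib_gramPencil hAC hXY (by omega))
        (by omega) (by omega) (by omega) (hL.mono fun ω h => h.1) hw hv
  · intro hle
    -- With no `α` and no `β` left, the block matrices depend on the dimensions alone, at every
    -- sample point.
    obtain rfl : s = 0 := by omega
    refine ⟨rfl, sigmaA m k r Fin.elim0, sigmaC q k r Fin.elim0, Filter.Eventually.of_forall
      fun ω G => ⟨?_, ?_⟩⟩
    · rw [GSVD.SigmaA, Subsingleton.elim G.α]
    · rw [GSVD.SigmaC, Subsingleton.elim G.β]
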